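/- **System model.** Let $A$, $B$ be process templates with finite disjoint state sets $Q_A,Q_B$, initial states $\mathsf{init}_A,\mathsf{init}_B$, finite input alphabets $\Sigma_A,\Sigma_B$ and guarded transitions $\delta_U\subseteq Q_U\times\Sigma_U\times\mathcal P(Q_A\cup Q_B)\times Q_U$ for $U\in\{A,B\}$. The system $(A,B)^{(1,n)}$ consists of one copy of $A$ and $n$ copies $B_1,\dots,B_n$ of $B$. For a global state $s$, a global input $e$ and a process $p$, a local transition $(s(p),e(p),g,q')$ of $p$ is *enabled* if its guard is satisfied conjunctively: $s(p')\in g$ for all processes $p'\ne p$. The process $p$ is *enabled* if one of its transitions is, otherwise *disabled*. The system type $(A,B)$ is *$1$-conjunctive* if every guard is of the form $(Q_A\cup Q_B)\setminus\{q\}$ and contains $\mathsf{init}_A$ and $\mathsf{init}_B$. **Runs.** A *run* is a sequence of configurations $(s_t,e_t,p_t)$ that starts with all processes in their initial states and with arbitrary inputs. In each step exactly the process $p_t$ moves, by an enabled transition, and the inputs of all other processes stay unchanged (the mover's next input is arbitrary). A run is infinite, or ends in a configuration in which all processes are disabled. An infinite run is *strong-fair* if every process that is enabled infinitely often moves infinitely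 often; *initializing* if every process that moves infinitely often is in its initial state infinitely often; *locally deadlocked* if some process is disabled from some moment on. **Deadlocks.** Consider deadlocks on strong-fair initializing or finite runs: $(A,B)^{(1,n)}$ has a *global deadlock* if it has a finite run; it has a *local deadlock* if it has an infinite strong-fair initializing run that is locally deadlocked; it has a *deadlock* if it has a global or a local one. **Statement.** Let $(A,B)$ be $1$-conjunctive. 1. (Bounding, global.) Let $c=2|Q_B\setminus\{\mathsf{init}_B\}|$ and $n>c$. If $(A,B)^{(1,n)}$ has a global deadlock, then so has $(A,B)^{(1,c)}$ (for $c=0$ this is the process $A$ alone). 2. (Bounding, local.) Let $|Q_B|>2$, $c=2|Q_B\setminus\{\mathsf{init}_B\}|+1$ and $n>c$. If $(A,B)^{(1,n)}$ has a local deadlock, then so has $(A,B)^{(1,c)}$. 3. (Bounding, general.) Let $|Q_B|>2$, $c=2|Q_B\setminus\{\mathsf{init}_B\}|$ and $n>c$. If $(A,B)^{(1,n)}$ has a deadlock, then so has $(A,B)^{(1,c)}$. 4. (Monotonicity.) Let $n\ge1$ and suppose that all strong-fair runs of $(A,B)^{(1,n+1)}$ are initializing. If $(A,B)^{(1,n)}$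 has a deadlock, then so has $(A,B)^{(1,n+1)}$. 5. (Cutoff.) Let $|Q_B|>2$, $c=2|Q_B|-2$, and suppose that for every $n>c$ all strong-fair runs of $(A,B)^{(1,n)}$ are initializing. Then for all $n\ge c$, $(A,B)^{(1,c)}$ has a deadlock if and only if $(A,B)^{(1,n)}$ has a deadlock. -/

import Mathlib

open Filter

namespace GuardedProtocol

/-- A process template with states `Q`, inputs `S` and guards that are sets of elements of `G`
(`G` is the disjoint union of the state sets of the two templates of a system): an initial state
and a guarded transition relation. -/
structure Template (Q S G : Type*) where
  init : Q
  trans : Set (Q × S × Set G × Q)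

/-- The processes of `(A,B)^{(1,n)}`: one copy of `A` and `n` copies of `B`. -/
inductive Proc (n : ℕ) where
  | procA : Proc n
  | procB : Fin n → Proc n

/-- Tuples with one `X`-entry for the process `A` and one `Y`-entry for each of the `n` copies of
`B`; used for global states and for global inputs. -/
structure Global (X Y : Type*) (n : ℕ) where
  a : X
  b : Fin n → Y

/-- The entry `s(p)` that belongs to the process `p`, as an element of the disjoint union. -/
def Global.at {X Y : Type*} {n : ℕ} (s : Global X Y n) : Proc n → X ⊕ Y
  | .procA => Sum.inl s.a
  | .procB i => Sum.inr (s.b i)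

/-- A configuration `(s, e, p)`; `mover = none` stands for `p = ⊥`. -/
structure Config (QA SA QB SB : Type*) (n : ℕ) where
  state : Global QA QB n
  input : Global SA SB n
  mover : Option (Proc n)

section System

variable {QA SA QB SB : Type*}

/-- The system type `(A,B)` is `1`-conjunctive: every guard of a transition of `A` or `B` is of
the form `(Q_A ∪ Q_B) \ {q}`, and (as in every conjunctive system) the two initial states are
contained in every guard. -/
def OneConjunctive (A : Template QA SA (QA ⊕ QB)) (B : Template QB SB (QA ⊕ QB)) : Prop :=
  ∀ g : Set (QA ⊕ QB),
    ((∃ q σ q', (q, σ, g, q') ∈ A.trans) ∨ (∃ q σ q', (q, σ, g, q') ∈ B.trans)) →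
      (∃ q : QA ⊕ QB, g = {q}ᶜ) ∧ Sum.inl A.init ∈ g ∧ Sum.inr B.init ∈ g

/-- Conjunctive satisfaction `(s,p) ⊨ g` of a guard: the states of all processes different from
`p` belong to `g`. -/
def SatGuard {n : ℕ} (s : Global QA QB n) (p : Proc n) (g : Set (QA ⊕ QB)) : Prop :=
  ∀ p' : Proc n, p' ≠ p → s.at p' ∈ g

variable (A : Template QA SA (QA ⊕ QB)) (B : Template QB SB (QA ⊕ QB))

/-- The process `p` is enabled for the global state `s` and the global input `e`. -/
def Enabled {n : ℕ} (s : Global QA QB n) (e : Global SA SB n) : Proc n → Prop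
  | .procA => ∃ g q', (s.a, e.a, g, q') ∈ A.trans ∧ SatGuard s .procA g
  | .procB i => ∃ g q', (s.b i, e.b i, g, q') ∈ B.trans ∧ SatGuard s (.procB i) g

/-- The global transition `(s, e, s')` based on a local transition of the process `p`. -/
def Step {n : ℕ} (s : Global QA QB n) (e : Global SA SB n) (s' : Global QA QB n) :
    Proc n → Prop
  | .procA => (∃ g, (s.a, e.a, g, s'.a) ∈ A.trans ∧ SatGuard s .procA g) ∧ s'.b = s.b
  | .procB i => (∃ g, (s.b i, e.b i, g, s'.b i) ∈ B.trans ∧ SatGuard s (.procB i) g) ∧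
      s'.a = s.a ∧ ∀ j, j ≠ i → s'.b j = s.b j

/-- `c'` may follow `c` in a path: the process that moves at `c` makes a transition, and the
inputs of all other processes stay the same. -/
def Next {n : ℕ} (c c' : Config QA SA QB SB n) : Prop :=
  ∃ p, c.mover = some p ∧ Step A B c.state c.input c'.state p ∧
    ∀ p', p' ≠ p → c'.input.at p' = c.input.at p'

/-- All processes are in their initial states. -/
def IsInitial {n : ℕ} (s : Global QA QB n) : Prop :=
  s.a = A.init ∧ ∀ i, s.b i = B.init

/-- The process `p` is in its initial state. -/
def AtInit {n : ℕ} (s : Global QA QB n) : Proc n → Prop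
  | .procA => s.a = A.init
  | .procB i => s.b i = B.init

/-- Infinite runs. (A path never contains `⊥` before its end, so that in an infinite path the
requirement that `⊥` appears exactly where all processes are disabled holds automatically.) -/
def IsInfiniteRun {n : ℕ} (x : ℕ → Config QA SA QB SB n) : Prop :=
  IsInitial A B (x 0).state ∧ ∀ t, Next A B (x t) (x (t + 1))

/-- `x 0, …, x d` is a finite run: it ends in a configuration `(s, e, ⊥)`, in which all processes
are disabled. The values `x t` for `t > d` are irrelevant. -/
def IsFiniteRun {n : ℕ} (x : ℕ → Config QA SA QB SB n) (d : ℕ) : Prop :=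
  IsInitial A B (x 0).state ∧ (∀ t, t < d → Next A B (x t) (x (t + 1))) ∧
    (x d).mover = none ∧ ∀ p, ¬ Enabled A B (x d).state (x d).input p

/-- An infinite run is strong-fair: every process that is enabled infinitely often moves
infinitely often. -/
def StrongFair {n : ℕ} (x : ℕ → Config QA SA QB SB n) : Prop :=
  ∀ p, (∃ᶠ t in atTop, Enabled A B (x t).state (x t).input p) →
    ∃ᶠ t in atTop, (x t).mover = some p

/-- An infinite run is initializing: every process that moves infinitely often is in its initial
state infinitely often. -/
def Initializing {n : ℕ} (x : ℕ → Config QA SA QB SB n) : Prop :=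
  ∀ p, (∃ᶠ t in atTop, (x t).mover = some p) → ∃ᶠ t in atTop, AtInit A B (x t).state p

/-- An infinite run is locally deadlocked for `p`: from some moment on, `p` is disabled. -/
def LocallyDeadlocked {n : ℕ} (x : ℕ → Config QA SA QB SB n) (p : Proc n) : Prop :=
  ∀ᶠ t in atTop, ¬ Enabled A B (x t).state (x t).input p

/-- `(A,B)^{(1,n)}` has a global deadlock: it has a finite run. -/
def HasGlobalDeadlock (n : ℕ) : Prop :=
  ∃ (x : ℕ → Config QA SA QB SB n) (d : ℕ), IsFiniteRun A B x d

/-- `(A,B)^{(1,n)}` has a local deadlock on strong-fair initializing runs. -/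
def HasLocalDeadlock (n : ℕ) : Prop :=
  ∃ x : ℕ → Config QA SA QB SB n, IsInfiniteRun A B x ∧ StrongFair A B x ∧
    Initializing A B x ∧ ∃ p, LocallyDeadlocked A B x p

/-- `(A,B)^{(1,n)}` has a deadlock on strong-fair initializing or finite runs. -/
def HasDeadlock (n : ℕ) : Prop :=
  HasGlobalDeadlock A B n ∨ HasLocalDeadlock A B n

/-- All strong-fair (infinite) runs of `(A,B)^{(1,n)}` are initializing. -/
def InitializingSystem (n : ℕ) : Prop :=
  ∀ x : ℕ → Config QA SA QB SB n, IsInfiniteRun A B x → StrongFair A B x → Initializing A B x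

/-- `c` is a cutoff for deadlock detection (on strong-fair initializing or finite runs). -/
def IsDeadlockCutoff (c : ℕ) : Prop :=
  ∀ n, c ≤ n → (HasDeadlock A B c ↔ HasDeadlock A B n)

end System

end GuardedProtocol

namespace GuardedProtocol

/-! ### Paths, lassos and fair schedules in labelled transition systems -/

section LTS

variable {X P I : Type*}

/-- `f 0, …, f L` is a path of a labelled transition relation, with labels `m 0, …, m (L - 1)`. -/
def IsPath (S : P → X → X → Prop) (L : ℕ) (f : ℕ → X) (m : ℕ → P) : Prop :=
  ∀ t < L, S (m t) (f t) (f (t + 1))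

/-- The unlabelled relation of a labelled transition relation. -/
def Edge (S : P → X → X → Prop) (x y : X) : Prop := ∃ p, S p x y

theorem IsPath.append {S : P → X → X → Prop} {L M : ℕ} {f g : ℕ → X} {m k : ℕ → P}
    (h : IsPath S L f m) (h' : IsPath S M g k) (hfg : f L = g 0) :
    IsPath S (L + M) (fun t => if t < L then f t else g (t - L))
      (fun t => if t < L then m t else k (t - L)) := by
  intro t ht
  by_cases h1 : t + 1 < L
  · have h2 : t < L := by omega
    simpa [h1, h2] using h t h2
  · by_cases h2 : t < L
    · have h3 : t + 1 = L := by omega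
      have := h t h2
      simp only [h2, if_true, h3, lt_irrefl, if_false, Nat.sub_self]
      rw [← hfg, ← h3]
      exact this
    · have h3 : t + 1 - L = t - L + 1 := by omega
      simp only [h1, h2, if_false, h3]
      exact h' _ (by omega)

theorem exists_isPath_of_reflTransGen [Nonempty P] {S : P → X → X → Prop} {a b : X}
    (h : Relation.ReflTransGen (Edge S) a b) :
    ∃ L f m, f 0 = a ∧ f L = b ∧ IsPath S L f m := by
  induction h with
  | refl => exact ⟨0, fun _ => a, fun _ => Classical.arbitrary P, rfl, rfl, fun t ht => by omega⟩
  | @tail b c _ hbc ih =>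
    obtain ⟨L, f, m, h0, hL, hp⟩ := ih
    obtain ⟨p, hp'⟩ := hbc
    have h1 : IsPath S 1 (fun t => if t = 0 then b else c) (fun _ => p) := by
      intro t ht
      obtain rfl : t = 0 := by omega
      simpa using hp'
    refine ⟨L + 1, _, _, ?_, ?_, hp.append h1 (by simpa using hL)⟩
    · by_cases h : 0 < L
      · simpa [h] using h0
      · obtain rfl : L = 0 := by omega
        simp [← h0, hL]
    · simp

/-- Loops through the common point `c` can be concatenated, so one loop collects the events of all.
-/
theorem exists_cycle [Nonempty P] {S : P → X → X → Prop} {c : X} {ev : I → P → X → Prop}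
    (h : ∀ i, ∃ x y p, Relation.ReflTransGen (Edge S) c x ∧ S p x y ∧ ev i p x ∧
      Relation.ReflTransGen (Edge S) y c) (s : Finset I) :
    ∃ L f m, f 0 = c ∧ f L = c ∧ IsPath S L f m ∧ ∀ i ∈ s, ∃ t < L, ev i (m t) (f t) := by
  classical
  induction s using Finset.induction_on with
  | empty =>
    exact ⟨0, fun _ => c, fun _ => Classical.arbitrary P, rfl, rfl, fun t ht => by omega, by simp⟩
  | insert i s _ ih =>
    obtain ⟨L, f, m, h0, hL, hp, hev⟩ := ih
    obtain ⟨x, y, p, hcx, hxy, hi, hyc⟩ := h i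
    obtain ⟨L₁, f₁, m₁, h0₁, hL₁, hp₁⟩ := exists_isPath_of_reflTransGen hcx
    obtain ⟨L₂, f₂, m₂, h0₂, hL₂, hp₂⟩ := exists_isPath_of_reflTransGen hyc
    have h1 : IsPath S 1 (fun t => if t = 0 then x else y) (fun _ => p) := by
      intro t ht
      obtain rfl : t = 0 := by omega
      simpa using hxy
    have hA := h1.append hp₂ (by simp [h0₂])
    have hB := hp₁.append hA (by simp [hL₁])
    have hC := hp.append hB (by
      by_cases h : 0 < L₁
      · simp [h, hL, h0₁]
      · obtain rfl : L₁ = 0 := by omega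
        simp [hL, ← hL₁, h0₁])
    refine ⟨_, _, _, ?_, ?_, hC, ?_⟩
    · by_cases h : 0 < L
      · simp [h, h0]
      · obtain rfl : L = 0 := by omega
        by_cases h : 0 < L₁
        · simp [h, h0₁]
        · obtain rfl : L₁ = 0 := by omega
          simp [← hL₁, h0₁]
    · simp [hL₂]
    · intro j hj
      rcases Finset.mem_insert.1 hj with rfl | hj
      · exact ⟨L + L₁, by omega, by simpa using hi⟩
      · obtain ⟨t, ht, h⟩ := hev j hj
        exact ⟨t, by omega, by simpa [ht] using h⟩

/-- The stem leads to `c`, and a loop with all events is repeated forever; `Inv` is required only on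
the loop. -/
theorem exists_lasso [Nonempty P] [Finite I] [Nonempty I] {S S' : P → X → X → Prop} {a c : X}
    {ev : I → P → X → Prop} {Inv : X → Prop} (hS : ∀ p x y, S' p x y → S p x y ∧ Inv x)
    (hac : Relation.ReflTransGen (Edge S) a c)
    (h : ∀ i, ∃ x y p, Relation.ReflTransGen (Edge S') c x ∧ S' p x y ∧ ev i p x ∧
      Relation.ReflTransGen (Edge S') y c) :
    ∃ (f : ℕ → X) (m : ℕ → P), f 0 = a ∧ (∀ t, S (m t) (f t) (f (t + 1))) ∧
      (∀ i, ∃ᶠ t in atTop, ev i (m t) (f t)) ∧ ∀ᶠ t in atTop, Inv (f t) := by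
  obtain ⟨_⟩ := nonempty_fintype I
  obtain ⟨K, g, k, hg0, hgK, hp⟩ := exists_isPath_of_reflTransGen hac
  obtain ⟨L, f, m, h0, hL, hq, hev⟩ := exists_cycle h Finset.univ
  have hpos : 0 < L := by
    obtain ⟨t, ht, _⟩ := hev (Classical.arbitrary I) (Finset.mem_univ _)
    omega
  have hstep : ∀ u, S' (m (u % L)) (f (u % L)) (f ((u + 1) % L)) := by
    intro u
    have hu : u % L < L := Nat.mod_lt _ hpos
    have := hq _ hu
    by_cases h1 : u % L + 1 < L
    · rwa [← Nat.mod_add_mod, Nat.mod_eq_of_lt h1]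
    · have h2 : u % L + 1 = L := by omega
      have h3 : (u + 1) % L = 0 := by
        rw [← Nat.mod_add_mod, h2, Nat.mod_self]
      rw [h3, h0, ← hL]
      rwa [h2] at this
  refine ⟨fun t => if t < K then g t else f ((t - K) % L),
    fun t => if t < K then k t else m ((t - K) % L), ?_, ?_, ?_, ?_⟩
  · by_cases h : 0 < K
    · simp [h, hg0]
    · obtain rfl : K = 0 := by omega
      simp [h0, ← hgK, hg0]
  · intro t
    by_cases h1 : t + 1 < K
    · have h2 : t < K := by omega
      simpa [h1, h2] using hp t h2
    · by_cases h2 : t < K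
      · have h3 : t + 1 = K := by omega
        have := hp t h2
        simp only [h2, if_true, h3, lt_irrefl, if_false, Nat.sub_self, Nat.zero_mod, h0]
        rw [← hgK, ← h3]
        exact this
      · have h3 : t + 1 - K = t - K + 1 := by omega
        simp only [h1, h2, if_false, h3]
        exact (hS _ _ _ (hstep _)).1
  · intro i
    obtain ⟨t, ht, h⟩ := hev i (Finset.mem_univ _)
    refine frequently_atTop.2 fun b => ⟨K + (t + L * b), ?_, ?_⟩
    · have : 1 * b ≤ L * b := Nat.mul_le_mul_right _ hpos
      omega
    · simpa [Nat.mod_eq_of_lt ht] using h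
  · filter_upwards [eventually_ge_atTop K] with t ht
    simp only [not_lt.2 ht, if_false]
    exact (hS _ _ _ (hstep _)).2

/-- A scheduler that always picks an enabled process that has moved least recently is
strong-fair. -/
theorem exists_fair_run [Finite P] (S : P → X → X → Prop) (a : X)
    (hen : ∀ x, Relation.ReflTransGen (Edge S) a x → ∃ p y, S p x y) :
    ∃ (f : ℕ → X) (m : ℕ → P), f 0 = a ∧ (∀ t, S (m t) (f t) (f (t + 1))) ∧
      ∀ p, (∃ᶠ t in atTop, ∃ y, S p (f t) y) → ∃ᶠ t in atTop, m t = p := by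
  classical
  let Y := {x // Relation.ReflTransGen (Edge S) a x}
  have hpick : ∀ (x : Y) (l : P → ℕ), ∃ (p : P) (y : Y), S p x.1 y.1 ∧
      ∀ p', (∃ y', S p' x.1 y') → l p ≤ l p' := by
    intro x l
    obtain ⟨p, hp, hmin⟩ := Set.exists_min_image {p | ∃ y, S p x.1 y} l (Set.toFinite _)
      (hen x.1 x.2)
    obtain ⟨y, hy⟩ := hp
    exact ⟨p, ⟨y, x.2.tail ⟨p, hy⟩⟩, hy, fun p' hp' => hmin p' hp'⟩
  choose pick next hnext hleast using hpick
  -- The label of a process is one plus the time of its last move, and `0` before its first.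
  let F : ℕ → Y × (P → ℕ) := fun t => Nat.rec (⟨a, Relation.ReflTransGen.refl⟩, fun _ => 0)
    (fun t z => (next z.1 z.2, Function.update z.2 (pick z.1 z.2) (t + 1))) t
  have hF : ∀ t, F (t + 1) = (next (F t).1 (F t).2,
    Function.update (F t).2 (pick (F t).1 (F t).2) (t + 1)) := fun t => rfl
  have hle : ∀ t p, (F t).2 p ≤ t := by
    intro t p
    induction t with
    | zero => exact le_rfl
    | succ t ih =>
      rw [hF]
      by_cases h : p = pick (F t).1 (F t).2
      · simp [h]
      · simp only [Function.update_of_ne h]; omega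
  have hmono : ∀ p, Monotone fun t => (F t).2 p := by
    intro p
    refine monotone_nat_of_le_succ fun t => ?_
    rw [hF]
    by_cases h : p = pick (F t).1 (F t).2
    · subst h
      simp only [Function.update_self]
      have := hle t (pick (F t).1 (F t).2)
      omega
    · simp only [Function.update_of_ne h]; exact le_rfl
  refine ⟨fun t => (F t).1.1, fun t => pick (F t).1 (F t).2, rfl, fun t => ?_, fun p hp => ?_⟩
  · exact hnext _ _
  · by_contra hcon
    rw [not_frequently, eventually_atTop] at hcon
    obtain ⟨T, hT⟩ := hcon
    have hconst : ∀ t, T ≤ t → (F t).2 p = (F T).2 p := by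
      intro t ht
      induction t, ht using Nat.le_induction with
      | base => rfl
      | succ t ht ih =>
        rw [hF, ← ih]
        exact Function.update_of_ne (fun h => hT t ht h.symm) _ _
    have hinf : {t | T ≤ t ∧ ∃ y, S p (F t).1.1 y}.Infinite := by
      rw [← Nat.frequently_atTop_iff_infinite]
      exact (eventually_ge_atTop T).and_frequently hp
    -- Some process is picked at two moments `t < u` after `T` at which `p` is enabled. At `u` its
    -- label exceeds `T` while that of `p` does not, so it was not a least recent choice.
    obtain ⟨t, ht, u, hu, hne, heq⟩ := hinf.exists_ne_map_eq_of_mapsTo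
      (f := fun t => pick (F t).1 (F t).2) (t := Set.univ) (fun _ _ => Set.mem_univ _)
      (Set.toFinite _)
    wlog htu : t < u generalizing t u
    · exact this u hu t ht hne.symm heq.symm (by omega)
    have h1 : (F (t + 1)).2 (pick (F t).1 (F t).2) = t + 1 := by
      rw [hF]; simp
    have h2 := hmono (pick (F t).1 (F t).2) (show t + 1 ≤ u by omega)
    have h3 := hleast (F u).1 (F u).2 p hu.2
    rw [hconst u hu.1] at h3
    have h4 := hle T p
    have h5 := ht.1
    simp only at heq h2
    rw [h1, heq] at h2
    omega

end LTS
end GuardedProtocol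

namespace GuardedProtocol

/-! ### Moves, reachability and deadlocks in terms of configurations without movers -/

section Basics

variable {QA SA QB SB : Type*} {n N : ℕ}

instance : Nonempty (Proc n) := ⟨.procA⟩

instance : Finite (Proc n) :=
  Finite.of_injective (β := Option (Fin n))
    (fun p => match p with | .procA => none | .procB i => some i)
    (by rintro (_ | i) (_ | j) h <;> simp_all)

/-- A global state together with a global input. -/
abbrev SI (QA SA QB SB : Type*) (n : ℕ) := Global QA QB n × Global SA SB n

variable (A : Template QA SA (QA ⊕ QB)) (B : Template QB SB (QA ⊕ QB))

/-- The process `p` moves from `x` to `y`. -/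
def Move (p : Proc n) (x y : SI QA SA QB SB n) : Prop :=
  Step A B x.1 x.2 y.1 p ∧ ∀ p', p' ≠ p → y.2.at p' = x.2.at p'

/-- `g` is the guard of a local transition of `p` at `x`. -/
def HasGuard (x : SI QA SA QB SB n) : Proc n → Set (QA ⊕ QB) → Prop
  | .procA, g => ∃ q', (x.1.a, x.2.a, g, q') ∈ A.trans
  | .procB i, g => ∃ q', (x.1.b i, x.2.b i, g, q') ∈ B.trans

/-- `x` is reachable. -/
def Reach (x : SI QA SA QB SB n) : Prop :=
  ∃ x₀ : SI QA SA QB SB n, IsInitial A B x₀.1 ∧ Relation.ReflTransGen (Edge (Move A B)) x₀ x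

variable {A B}

theorem enabled_iff {x : SI QA SA QB SB n} {p : Proc n} :
    Enabled A B x.1 x.2 p ↔ ∃ g, HasGuard A B x p g ∧ SatGuard x.1 p g := by
  cases p with
  | procA =>
    exact ⟨fun ⟨g, q, h, h'⟩ => ⟨g, ⟨q, h⟩, h'⟩, fun ⟨g, ⟨q, h⟩, h'⟩ => ⟨g, q, h, h'⟩⟩
  | procB i =>
    exact ⟨fun ⟨g, q, h, h'⟩ => ⟨g, ⟨q, h⟩, h'⟩, fun ⟨g, ⟨q, h⟩, h'⟩ => ⟨g, q, h, h'⟩⟩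

theorem OneConjunctive.of_hasGuard (hAB : OneConjunctive A B) {x : SI QA SA QB SB n}
    {p : Proc n} {g : Set (QA ⊕ QB)} (h : HasGuard A B x p g) :
    ∃ q, g = {q}ᶜ ∧ q ≠ Sum.inl A.init ∧ q ≠ Sum.inr B.init := by
  have : (∃ q, g = {q}ᶜ) ∧ Sum.inl A.init ∈ g ∧ Sum.inr B.init ∈ g := by
    apply hAB
    cases p with
    | procA => obtain ⟨q, h⟩ := h; exact Or.inl ⟨_, _, _, h⟩
    | procB i => obtain ⟨q, h⟩ := h; exact Or.inr ⟨_, _, _, h⟩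
  obtain ⟨⟨q, rfl⟩, h1, h2⟩ := this
  exact ⟨q, rfl, fun h => h1 h.symm, fun h => h2 h.symm⟩

/-- `x` with a new state and input of `A`. -/
def setA (x : SI QA SA QB SB n) (q : QA) (σ : SA) : SI QA SA QB SB n :=
  (⟨q, x.1.b⟩, ⟨σ, x.2.b⟩)

/-- `x` with a new state and input of `B_i`. -/
def setB (x : SI QA SA QB SB n) (i : Fin n) (q : QB) (σ : SB) : SI QA SA QB SB n :=
  (⟨x.1.a, Function.update x.1.b i q⟩, ⟨x.2.a, Function.update x.2.b i σ⟩)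

theorem move_setA {x : SI QA SA QB SB n} {g : Set (QA ⊕ QB)} {q : QA} (σ : SA)
    (h : (x.1.a, x.2.a, g, q) ∈ A.trans) (hg : SatGuard x.1 .procA g) :
    Move A B .procA x (setA x q σ) := by
  refine ⟨⟨⟨g, h, hg⟩, rfl⟩, ?_⟩
  rintro (_ | j) hj
  · exact absurd rfl hj
  · rfl

theorem move_setB {x : SI QA SA QB SB n} {i : Fin n} {g : Set (QA ⊕ QB)} {q : QB} (σ : SB)
    (h : (x.1.b i, x.2.b i, g, q) ∈ B.trans) (hg : SatGuard x.1 (.procB i) g) :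
    Move A B (.procB i) x (setB x i q σ) := by
  refine ⟨⟨⟨g, by simpa [setB] using h, hg⟩, rfl, fun j hj => ?_⟩, ?_⟩
  · simp [setB, hj]
  · rintro (_ | j) hj
    · rfl
    · have : j ≠ i := fun h => hj (by rw [h])
      simp [setB, Global.at, this]

theorem exists_move {x : SI QA SA QB SB n} {p : Proc n} (h : Enabled A B x.1 x.2 p) :
    ∃ y, Move A B p x y := by
  cases p with
  | procA => obtain ⟨g, q, h, hg⟩ := h; exact ⟨_, move_setA x.2.a h hg⟩
  | procB i => obtain ⟨g, q, h, hg⟩ := h; exact ⟨_, move_setB (x.2.b i) h hg⟩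

theorem Move.enabled {x y : SI QA SA QB SB n} {p : Proc n} (h : Move A B p x y) :
    Enabled A B x.1 x.2 p := by
  cases p with
  | procA => obtain ⟨⟨⟨g, h, hg⟩, _⟩, _⟩ := h; exact ⟨g, _, h, hg⟩
  | procB i => obtain ⟨⟨⟨g, h, hg⟩, _⟩, _⟩ := h; exact ⟨g, _, h, hg⟩

theorem Move.state_eq {x y : SI QA SA QB SB n} {p p' : Proc n} (h : Move A B p x y)
    (hp : p' ≠ p) : y.1.at p' = x.1.at p' := by
  cases p with
  | procA =>
    cases p' with
    | procA => exact absurd rfl hp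
    | procB j => exact congrArg Sum.inr (congrFun h.1.2 j)
  | procB i =>
    cases p' with
    | procA => exact congrArg Sum.inl h.1.2.1
    | procB j => exact congrArg Sum.inr (h.1.2.2 j fun h => hp (by rw [h]))

theorem Move.input_eq {x y : SI QA SA QB SB n} {p p' : Proc n} (h : Move A B p x y)
    (hp : p' ≠ p) : y.2.at p' = x.2.at p' := h.2 p' hp

/-- Local transitions depend only on the state and input of the process itself, so guards transfer
between systems of different sizes. -/
theorem HasGuard.congr {x : SI QA SA QB SB n} {y : SI QA SA QB SB N} {p : Proc n} {p' : Proc N}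
    (h1 : y.1.at p' = x.1.at p) (h2 : y.2.at p' = x.2.at p) {g : Set (QA ⊕ QB)}
    (h : HasGuard A B y p' g) : HasGuard A B x p g := by
  cases p <;> cases p' <;>
    simp only [Global.at, Sum.inl.injEq, Sum.inr.injEq, reduceCtorEq] at h1 h2 <;>
    simpa only [HasGuard, h1, h2] using h

/-- The configuration with `N` copies of `B` in which `B_j` behaves like `B_i` if `φ j = some i`,
and stays in its initial state if `φ j = none`. -/
def pull (B : Template QB SB (QA ⊕ QB)) (φ : Fin N → Option (Fin n)) (ι : Fin N → SB)
    (x : SI QA SA QB SB n) : SI QA SA QB SB N :=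
  (⟨x.1.a, fun j => (φ j).elim B.init x.1.b⟩, ⟨x.2.a, fun j => (φ j).elim (ι j) x.2.b⟩)

/-- Forgetting processes only makes guards easier to satisfy, and idle copies are harmless since
`B.init` lies in every guard. A move of a forgotten process becomes an empty path. -/
theorem edge_pull (hAB : OneConjunctive A B) {φ : Fin N → Option (Fin n)} (ι : Fin N → SB)
    (hφ : ∀ j j' i, φ j = some i → φ j' = some i → j = j') {x y : SI QA SA QB SB n}
    (h : Edge (Move A B) x y) :
    Relation.ReflTransGen (Edge (Move A B)) (pull B φ ι x) (pull B φ ι y) := by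
  obtain ⟨p, hp⟩ := h
  cases p with
  | procA =>
    obtain ⟨⟨⟨g, h, hg⟩, hb⟩, he⟩ := hp
    have hi := (hAB g (Or.inl ⟨_, _, _, h⟩)).2.2
    refine Relation.ReflTransGen.single ⟨.procA, ⟨⟨g, h, ?_⟩, ?_⟩, ?_⟩
    · rintro (_ | j) hj
      · exact absurd rfl hj
      · simp only [pull, Global.at]
        cases hφj : φ j with
        | none => exact hi
        | some i => exact hg (.procB i) (by simp)
    · simp only [pull, hb]
    · rintro (_ | j) hj
      · exact absurd rfl hj
      · simp only [pull, Global.at]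
        cases hφj : φ j with
        | none => rfl
        | some i => exact he (.procB i) (by simp)
  | procB i =>
    by_cases hr : ∃ j, φ j = some i
    · obtain ⟨j, hj⟩ := hr
      obtain ⟨⟨⟨g, h, hg⟩, ha, hb⟩, he⟩ := hp
      have hi := (hAB g (Or.inr ⟨_, _, _, h⟩)).2.2
      refine Relation.ReflTransGen.single ⟨.procB j, ⟨⟨g, ?_, ?_⟩, ha, ?_⟩, ?_⟩
      · simpa [pull, hj] using h
      · rintro (_ | j') hj'
        · exact hg .procA (by simp)
        · simp only [pull, Global.at]
          cases hφj : φ j' with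
          | none => exact hi
          | some i' =>
            refine hg (.procB i') fun h => hj' ?_
            simp only [Proc.procB.injEq] at h
            rw [hφ j j' i hj (h ▸ hφj)]
      · intro j' hj'
        simp only [pull]
        cases hφj : φ j' with
        | none => rfl
        | some i' => exact hb i' fun h => hj' (hφ j' j i (h ▸ hφj) hj)
      · rintro (_ | j') hj'
        · exact he .procA (by simp)
        · simp only [pull, Global.at]
          cases hφj : φ j' with
          | none => rfl
          | some i' =>
            refine he (.procB i') fun h => hj' ?_
            simp only [Proc.procB.injEq] at h
            rw [hφ j j' i hj (h ▸ hφj)]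
    · have hx : pull B φ ι y = pull B φ ι x := by
        have h1 : ∀ j i', φ j = some i' → Proc.procB i' ≠ .procB i := by
          rintro j i' hj h
          simp only [Proc.procB.injEq] at h
          exact hr ⟨j, h ▸ hj⟩
        have ha := Sum.inl_injective (hp.state_eq (p' := .procA) (by simp))
        have hea := Sum.inl_injective (hp.input_eq (p' := .procA) (by simp))
        simp only [pull, ha, hea, Prod.mk.injEq, Global.mk.injEq, true_and]
        constructor
        · funext j
          cases hj : φ j with
          | none => rfl
          | some i' => exact Sum.inr_injective (hp.state_eq (h1 j i' hj))
        · funext j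
          cases hj : φ j with
          | none => rfl
          | some i' => exact Sum.inr_injective (hp.input_eq (h1 j i' hj))
      rw [hx]

theorem Reach.pull (hAB : OneConjunctive A B) {φ : Fin N → Option (Fin n)} (ι : Fin N → SB)
    (hφ : ∀ j j' i, φ j = some i → φ j' = some i → j = j') {x : SI QA SA QB SB n}
    (h : Reach A B x) : Reach A B (pull B φ ι x) := by
  obtain ⟨x₀, h0, h⟩ := h
  refine ⟨GuardedProtocol.pull B φ ι x₀, ⟨h0.1, fun j => ?_⟩, ?_⟩
  · simp only [GuardedProtocol.pull]
    cases hφj : φ j with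
    | none => rfl
    | some i => exact h0.2 i
  · induction h with
    | refl => exact Relation.ReflTransGen.refl
    | tail _ h ih => exact ih.trans (edge_pull hAB ι hφ h)

theorem Reach.trans {x y : SI QA SA QB SB n} (h : Reach A B x)
    (hxy : Relation.ReflTransGen (Edge (Move A B)) x y) : Reach A B y :=
  let ⟨x₀, h0, h⟩ := h
  ⟨x₀, h0, h.trans hxy⟩

theorem Next.edge {c c' : Config QA SA QB SB n} (h : Next A B c c') :
    Edge (Move A B) (c.state, c.input) (c'.state, c'.input) := by
  obtain ⟨p, _, h1, h2⟩ := h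
  exact ⟨p, h1, h2⟩

theorem hasGlobalDeadlock_iff : HasGlobalDeadlock A B n ↔
    ∃ x : SI QA SA QB SB n, Reach A B x ∧ ∀ p, ¬ Enabled A B x.1 x.2 p := by
  constructor
  · rintro ⟨x, d, h0, hs, _, hd⟩
    refine ⟨((x d).state, (x d).input), ⟨((x 0).state, (x 0).input), h0, ?_⟩, hd⟩
    have : ∀ t ≤ d, Relation.ReflTransGen (Edge (Move A B)) ((x 0).state, (x 0).input)
        ((x t).state, (x t).input) := by
      intro t
      induction t with
      | zero => exact fun _ => Relation.ReflTransGen.refl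
      | succ t ih => exact fun ht => (ih (by omega)).tail (hs t (by omega)).edge
    exact this d le_rfl
  · rintro ⟨x, ⟨x₀, h0, h⟩, hd⟩
    obtain ⟨L, f, m, rfl, rfl, hp⟩ := exists_isPath_of_reflTransGen h
    refine ⟨fun t => ⟨(f t).1, (f t).2, if t < L then some (m t) else none⟩, L, h0, ?_, ?_, hd⟩
    · intro t ht
      exact ⟨m t, by simp [ht], hp t ht⟩
    · simp

theorem hasLocalDeadlock_of_run {f : ℕ → SI QA SA QB SB n} {m : ℕ → Proc n}
    (h0 : IsInitial A B (f 0).1) (hs : ∀ t, Move A B (m t) (f t) (f (t + 1)))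
    (hfair : ∀ p, (∃ᶠ t in atTop, Enabled A B (f t).1 (f t).2 p) → ∃ᶠ t in atTop, m t = p)
    (hinit : ∀ p, (∃ᶠ t in atTop, m t = p) → ∃ᶠ t in atTop, AtInit A B (f t).1 p)
    (hdead : ∃ p, ∀ᶠ t in atTop, ¬ Enabled A B (f t).1 (f t).2 p) :
    HasLocalDeadlock A B n := by
  refine ⟨fun t => ⟨(f t).1, (f t).2, some (m t)⟩, ⟨h0, fun t => ⟨m t, rfl, hs t⟩⟩, ?_, ?_, hdead⟩
  · intro p hp
    simpa using hfair p hp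
  · intro p hp
    exact hinit p (by simpa using hp)

/-- Each process outside `D` has a loop at `c` in which it moves from its initial state. Repeating
all these loops makes the run both strong-fair and initializing. -/
theorem hasLocalDeadlock_of_cycles {c : SI QA SA QB SB n} (hc : Reach A B c) (D : Set (Proc n))
    (Inv : SI QA SA QB SB n → Prop) (hInv : ∀ x, Inv x → ∀ p ∈ D, ¬ Enabled A B x.1 x.2 p)
    (hD : D.Nonempty) (hD' : Dᶜ.Nonempty)
    (h : ∀ p ∉ D, ∃ x y,
      Relation.ReflTransGen (Edge fun p x y => Move A B p x y ∧ Inv x ∧ Inv y) c x ∧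
      (Move A B p x y ∧ Inv x ∧ Inv y) ∧ AtInit A B x.1 p ∧
      Relation.ReflTransGen (Edge fun p x y => Move A B p x y ∧ Inv x ∧ Inv y) y c) :
    HasLocalDeadlock A B n := by
  obtain ⟨x₀, h0, hc⟩ := hc
  have : Nonempty ↥Dᶜ := hD'.to_subtype
  obtain ⟨f, m, hf0, hs, hev, hinv⟩ := exists_lasso (I := ↥Dᶜ) (S := Move A B)
    (S' := fun p x y => Move A B p x y ∧ Inv x ∧ Inv y) (Inv := Inv)
    (ev := fun i p x => p = i ∧ AtInit A B x.1 i) (fun _ _ _ h => ⟨h.1, h.2.1⟩) hc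
    (fun i => by
      obtain ⟨x, y, h1, h2, h3, h4⟩ := h i.1 i.2
      exact ⟨x, y, i, h1, h2, ⟨rfl, h3⟩, h4⟩)
  have hdead : ∀ p ∈ D, ∀ᶠ t in atTop, ¬ Enabled A B (f t).1 (f t).2 p := fun p hp =>
    hinv.mono fun t ht => hInv _ ht p hp
  have hmove : ∀ p ∈ D, ¬ ∃ᶠ t in atTop, m t = p := by
    intro p hp hcon
    obtain ⟨t, h1, h2⟩ := (hcon.and_eventually (hdead p hp)).exists
    subst h1
    exact h2 (hs t).enabled
  refine hasLocalDeadlock_of_run (hf0 ▸ h0) hs ?_ ?_ ?_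
  · intro p hp
    by_cases hpD : p ∈ D
    · exact absurd (hdead p hpD) hp
    · exact (hev ⟨p, hpD⟩).mono fun t h => h.1
  · intro p hp
    by_cases hpD : p ∈ D
    · exact absurd hp (hmove p hpD)
    · exact (hev ⟨p, hpD⟩).mono fun t h => h.2
  · obtain ⟨p, hp⟩ := hD
    exact ⟨p, hdead p hp⟩

/-- Mutually blocking processes remain disabled forever; so a strong-fair schedule of the other
processes is a deadlock. -/
theorem hasDeadlock_of_mutually_blocked (hI : InitializingSystem A B n) {x : SI QA SA QB SB n}
    (hx : Reach A B x) {D : Set (Proc n)} (hD : D.Nonempty)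
    (hb : ∀ p ∈ D, ∀ g, HasGuard A B x p g → ∃ p' ∈ D, p' ≠ p ∧ x.1.at p' ∉ g) :
    HasDeadlock A B n := by
  have hdis : ∀ y : SI QA SA QB SB n, (∀ p ∈ D, y.1.at p = x.1.at p ∧ y.2.at p = x.2.at p) →
      ∀ p ∈ D, ¬ Enabled A B y.1 y.2 p := by
    intro y hy p hp hen
    obtain ⟨g, hg, hsat⟩ := enabled_iff.1 hen
    obtain ⟨p', hp', hne, hn⟩ := hb p hp g (hg.congr (hy p hp).1 (hy p hp).2)
    have := hsat p' hne
    rw [(hy p' hp').1] at this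
    exact hn this
  have hedge : ∀ p y z, (∀ p ∈ D, y.1.at p = x.1.at p ∧ y.2.at p = x.2.at p) →
      Move A B p y z → (∀ p ∈ D, z.1.at p = x.1.at p ∧ z.2.at p = x.2.at p) := by
    intro p y z hy hm p' hp'
    have hne : p' ≠ p := by
      rintro rfl
      exact hdis y hy p' hp' hm.enabled
    rw [hm.state_eq hne, hm.input_eq hne]
    exact hy p' hp'
  -- Either the fair scheduler never gets stuck, or a configuration without moves is reachable and
  -- is a global deadlock.
  by_cases hen : ∀ y, Relation.ReflTransGen (Edge (Move A B)) x y → ∃ p z, Move A B p y z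
  · right
    obtain ⟨x₀, h0, hx⟩ := hx
    obtain ⟨K, g, k, hg0, hgK, hp⟩ := exists_isPath_of_reflTransGen hx
    obtain ⟨f, m, hf0, hs, hfair⟩ := exists_fair_run (Move A B) x hen
    have hkeep : ∀ t, ∀ p ∈ D, (f t).1.at p = x.1.at p ∧ (f t).2.at p = x.2.at p := by
      intro t
      induction t with
      | zero => rw [hf0]; exact fun p _ => ⟨rfl, rfl⟩
      | succ t ih => exact hedge _ _ _ ih (hs t)
    let r : ℕ → Config QA SA QB SB n := fun t => if t < K then ⟨(g t).1, (g t).2, some (k t)⟩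
      else ⟨(f (t - K)).1, (f (t - K)).2, some (m (t - K))⟩
    have hr : ∀ t, r (t + K) = ⟨(f t).1, (f t).2, some (m t)⟩ := by
      intro t
      simp [r]
    have hfreq : ∀ Φ : Config QA SA QB SB n → Prop,
        (∃ᶠ t in atTop, Φ (r t)) ↔ ∃ᶠ t in atTop, Φ ⟨(f t).1, (f t).2, some (m t)⟩ := by
      intro Φ
      rw [← Filter.map_add_atTop_eq_nat K, Filter.frequently_map,
        Filter.map_add_atTop_eq_nat K]
      simp only [hr]
    have hrun : IsInfiniteRun A B r := by
      constructor
      · by_cases h : 0 < K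
        · simpa [r, h, hg0] using h0
        · obtain rfl : K = 0 := by omega
          simpa [r, hf0, ← hgK, hg0] using h0
      · intro t
        by_cases h1 : t + 1 < K
        · have h2 : t < K := by omega
          simp only [r, h1, h2, if_true]
          exact ⟨_, rfl, hp t h2⟩
        · by_cases h2 : t < K
          · have h3 : t + 1 = K := by omega
            simp only [r, h2, if_true, h3, lt_irrefl, if_false, Nat.sub_self, hf0]
            have := hp t h2
            rw [h3, hgK] at this
            exact ⟨_, rfl, this⟩
          · have h3 : t + 1 - K = t - K + 1 := by omega
            simp only [r, h1, h2, if_false, h3]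
            exact ⟨_, rfl, hs _⟩
    have hsf : StrongFair A B r := by
      intro p hp
      rw [hfreq fun c => Enabled A B c.state c.input p] at hp
      rw [hfreq fun c => c.mover = some p]
      exact (hfair p (hp.mono fun t h => exists_move h)).mono fun t h => by rw [← h]
    obtain ⟨p, hp⟩ := hD
    refine ⟨r, hrun, hsf, hI r hrun hsf, p, ?_⟩
    by_contra hcon
    rw [LocallyDeadlocked, not_eventually] at hcon
    simp only [not_not] at hcon
    rw [hfreq fun c => Enabled A B c.state c.input p] at hcon
    obtain ⟨t, ht⟩ := hcon.exists
    exact hdis _ (hkeep t) p hp ht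
  · left
    push Not at hen
    obtain ⟨y, hy, hn⟩ := hen
    exact hasGlobalDeadlock_iff.2 ⟨y, hx.trans hy, fun p hp =>
      let ⟨z, hz⟩ := exists_move hp
      hn p z hz⟩

end Basics
end GuardedProtocol

namespace GuardedProtocol

/-! ### The local trajectory of a single process -/

section LocalPaths

variable {Q S : Type*} {L : Q × S → Q × S → Prop} {u : ℕ → Q × S} {mv : ℕ → Prop} {C : Q → Prop}
  {T : ℕ}

/-- A stutter at a state in `C` changes at most the input, which is absorbed by reaching each state
with every input `σ`. Starting outside `C` makes the first move a proper step. -/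
theorem eventually_transGen (hstay : ∀ t, ¬ mv t → u (t + 1) = u t)
    (hmove : ∀ t, T ≤ t → mv t →
      (∀ σ, L (u t) ((u (t + 1)).1, σ)) ∨ (C (u t).1 ∧ (u (t + 1)).1 = (u t).1))
    {t₁ : ℕ} (ht₁ : T ≤ t₁) (hC : ¬ C (u t₁).1) (hmv : ∃ᶠ t in atTop, mv t) :
    ∀ᶠ t in atTop, ∀ σ, Relation.TransGen L (u t₁) ((u t).1, σ) := by
  classical
  have hex : ∃ d, mv (t₁ + d) := by
    obtain ⟨t, ht, h⟩ := frequently_atTop.1 hmv t₁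
    exact ⟨t - t₁, by rwa [Nat.add_sub_cancel' ht]⟩
  have hconst : ∀ d ≤ Nat.find hex, u (t₁ + d) = u t₁ := by
    intro d
    induction d with
    | zero => exact fun _ => rfl
    | succ d ih =>
      intro hd
      rw [← add_assoc, hstay _ (Nat.find_min hex (by omega)), ih (by omega)]
  have hspec := Nat.find_spec hex
  have h2 := hconst _ le_rfl
  generalize Nat.find hex = d at hspec h2
  filter_upwards [eventually_ge_atTop (t₁ + d + 1)] with t ht
  induction t, ht using Nat.le_induction with
  | base =>
    intro σ
    rcases hmove _ (by omega) hspec with h | h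
    · exact Relation.TransGen.single (h2 ▸ h σ)
    · exact absurd (h2 ▸ h.1) hC
  | succ t ht ih =>
    intro σ
    by_cases hm : mv t
    · rcases hmove t (by omega) hm with h | h
      · exact (ih (u t).2).tail (h σ)
      · rw [h.2]; exact ih σ
    · rw [hstay t hm]; exact ih σ

/-- Stutters before the first proper step may change the input, so `ι` need not be the input at
`t₁`. -/
theorem exists_transGen_of_ne (hstay : ∀ t, ¬ mv t → u (t + 1) = u t)
    (hmove : ∀ t, T ≤ t → mv t →
      (∀ σ, L (u t) ((u (t + 1)).1, σ)) ∨ (C (u t).1 ∧ (u (t + 1)).1 = (u t).1))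
    {t₁ t₂ : ℕ} (ht₁ : T ≤ t₁) (ht₂ : t₁ ≤ t₂) (hne : (u t₂).1 ≠ (u t₁).1) :
    ∃ ι, ∀ σ, Relation.TransGen L ((u t₁).1, ι) ((u t₂).1, σ) := by
  suffices h : ∀ t, t₁ ≤ t → (u t).1 = (u t₁).1 ∨
      ∃ ι, ∀ σ, Relation.TransGen L ((u t₁).1, ι) ((u t).1, σ) from
    (h t₂ ht₂).resolve_left hne
  intro t ht
  induction t, ht using Nat.le_induction with
  | base => exact Or.inl rfl
  | succ t ht ih =>
    by_cases hm : mv t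
    · rcases hmove t (by omega) hm with h | h
      · right
        rcases ih with ih | ⟨ι, ih⟩
        · refine ⟨(u t).2, fun σ => Relation.TransGen.single ?_⟩
          rw [← ih]; exact h σ
        · exact ⟨ι, fun σ => (ih (u t).2).tail (h σ)⟩
      · rw [h.2]; exact ih
    · rw [hstay t hm]; exact ih

end LocalPaths

/-! ### Extracting a profile from a locally deadlocked run -/

section Profile

variable {QA SA QB SB : Type*} {n : ℕ}

/-- A local step (with an arbitrary next input) whose guard admits all states in `F`. -/
def LocalStep {Q S G : Type*} (U : Template Q S G) (F : Set G) (a b : Q × S) : Prop :=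
  ∃ g, (a.1, a.2, g, b.1) ∈ U.trans ∧ F ⊆ g

variable (A : Template QA SA (QA ⊕ QB)) (B : Template QB SB (QA ⊕ QB))

/-- The states that block a process of `D` at `x` although no other process of `D` is in them. -/
def Contested (x : SI QA SA QB SB n) (D : Set (Proc n)) : Set QB :=
  {r | ∃ p ∈ D, HasGuard A B x p {Sum.inr r}ᶜ ∧ ∀ p' ∈ D, p' ≠ p → x.1.at p' ≠ Sum.inr r}

/-- The states of the processes of `D`, and the contested states. -/
def Occupied (x : SI QA SA QB SB n) (D : Set (Proc n)) : Set (QA ⊕ QB) :=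
  {q | (∃ p ∈ D, x.1.at p = q) ∨ ∃ r ∈ Contested A B x D, q = Sum.inr r}

/-- A configuration `x` from which a strong-fair initializing run can go on with the processes in
`D` disabled forever, and the ways in which the other processes can move then. -/
structure Profile (x : SI QA SA QB SB n) (D : Set (Proc n)) : Prop where
  reach : Reach A B x
  dead_nonempty : D.Nonempty
  blocked : ∀ p ∈ D, ∀ g, HasGuard A B x p g →
    (∃ p' ∈ D, p' ≠ p ∧ x.1.at p' ∉ g) ∨ ∃ r ∈ Contested A B x D, g = {Sum.inr r}ᶜ
  cycleA : Proc.procA ∉ D → x.1.a = A.init ∧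
    Relation.TransGen (LocalStep A (Occupied A B x D)) (A.init, x.2.a) (A.init, x.2.a)
  cycleB : ∀ i, Proc.procB i ∉ D → ∃ σ₀,
    Relation.TransGen (LocalStep B (Occupied A B x D)) (B.init, σ₀) (B.init, σ₀) ∧
    ∀ r ∈ Contested A B x D,
      (∀ σ, Relation.TransGen (LocalStep B (Occupied A B x D)) (B.init, σ₀) (r, σ)) ∧
      ∃ σ, Relation.TransGen (LocalStep B (Occupied A B x D)) (r, σ) (B.init, σ₀)
  occupied : ∀ r ∈ Contested A B x D, ∃ i, Proc.procB i ∉ D ∧ x.1.b i = r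

/-- A run in which from `T` on exactly the processes in `D` are disabled forever. -/
structure Settled (y : ℕ → SI QA SA QB SB n) (m : ℕ → Proc n) (T : ℕ) (D : Set (Proc n)) :
    Prop where
  move : ∀ t, Move A B (m t) (y t) (y (t + 1))
  dead : ∀ p ∈ D, ∀ t, T ≤ t → ¬ Enabled A B (y t).1 (y t).2 p
  live : ∀ p ∉ D, ∃ᶠ t in atTop, m t = p
  init : ∀ p ∉ D, ∃ᶠ t in atTop, AtInit A B (y t).1 p
  start : Proc.procA ∉ D → (y T).1.a = A.init

variable {A B}

theorem Contested.ne_init (hAB : OneConjunctive A B) {x : SI QA SA QB SB n} {D : Set (Proc n)}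
    {r : QB} (hr : r ∈ Contested A B x D) : r ≠ B.init := by
  obtain ⟨p, _, hg, _⟩ := hr
  obtain ⟨q, hq, _, h⟩ := hAB.of_hasGuard hg
  rintro rfl
  rw [compl_inj_iff, Set.singleton_eq_singleton_iff] at hq
  exact h hq.symm

namespace Settled

variable {y : ℕ → SI QA SA QB SB n} {m : ℕ → Proc n} {T : ℕ} {D : Set (Proc n)}

theorem at_eq (h : Settled A B y m T D) {p : Proc n} (hp : p ∈ D) {t : ℕ} (ht : T ≤ t) :
    (y t).1.at p = (y T).1.at p ∧ (y t).2.at p = (y T).2.at p := by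
  induction t, ht using Nat.le_induction with
  | base => exact ⟨rfl, rfl⟩
  | succ t ht ih =>
    have hne : p ≠ m t := by
      rintro rfl
      exact h.dead _ hp t ht (h.move t).enabled
    rwa [(h.move t).state_eq hne, (h.move t).input_eq hne]

theorem exists_blocker (h : Settled A B y m T D) {p : Proc n} (hp : p ∈ D)
    {g : Set (QA ⊕ QB)} (hg : HasGuard A B (y T) p g) {t : ℕ} (ht : T ≤ t) :
    ∃ p', p' ≠ p ∧ (y t).1.at p' ∉ g := by
  by_contra hcon
  push Not at hcon
  exact h.dead p hp t ht (enabled_iff.2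
    ⟨g, hg.congr (h.at_eq hp ht).1.symm (h.at_eq hp ht).2.symm, hcon⟩)

/-- Dead processes do not move, and none but possibly the blocked one itself is in `r`; so a live
copy of `B` must do the blocking at each moment. -/
theorem occupied (h : Settled A B y m T D) {r : QB} (hr : r ∈ Contested A B (y T) D) {t : ℕ}
    (ht : T ≤ t) : ∃ i, Proc.procB i ∉ D ∧ (y t).1.b i = r := by
  obtain ⟨p, hp, hg, hn⟩ := hr
  obtain ⟨p', hne, hp'⟩ := h.exists_blocker hp hg ht
  rw [Set.mem_compl_iff, not_not, Set.mem_singleton_iff] at hp'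
  cases p' with
  | procA => simp [Global.at] at hp'
  | procB i =>
    refine ⟨i, fun hi => hn _ hi hne ?_, Sum.inr_injective hp'⟩
    rw [← (h.at_eq hi ht).1, hp']

theorem blocked (hAB : OneConjunctive A B) (h : Settled A B y m T D) {p : Proc n} (hp : p ∈ D)
    {g : Set (QA ⊕ QB)} (hg : HasGuard A B (y T) p g) :
    (∃ p' ∈ D, p' ≠ p ∧ (y T).1.at p' ∉ g) ∨
      ∃ r ∈ Contested A B (y T) D, g = {Sum.inr r}ᶜ := by
  by_cases hD : ∃ p' ∈ D, p' ≠ p ∧ (y T).1.at p' ∉ g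
  · exact Or.inl hD
  · right
    push Not at hD
    obtain ⟨q, rfl, hqA, -⟩ := hAB.of_hasGuard hg
    cases q with
    | inr r => exact ⟨r, ⟨p, hp, hg, fun p' hp' hne => hD p' hp' hne⟩, rfl⟩
    -- A forbidden state of `A` that no other dead process holds would be the state of a live `A` at
    -- time `T`. But then `A` is initial, and initial states are never forbidden.
    | inl q =>
      have key : ∀ t, T ≤ t → Proc.procA ≠ p ∧ (y t).1.a = q := by
        intro t ht
        obtain ⟨p', hne, hp'⟩ := h.exists_blocker hp hg ht
        rw [Set.mem_compl_iff, not_not, Set.mem_singleton_iff] at hp'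
        cases p' with
        | procA => exact ⟨hne, Sum.inl_injective hp'⟩
        | procB i => simp [Global.at] at hp'
      have hA : Proc.procA ∉ D := fun hA =>
        hD _ hA (key T le_rfl).1 (congrArg Sum.inl (key T le_rfl).2)
      exact absurd (congrArg Sum.inl ((key T le_rfl).2.symm.trans (h.start hA))) hqA

theorem localStepA (h : Settled A B y m T D) {t : ℕ} (ht : T ≤ t) (hm : m t = .procA) (σ : SA) :
    LocalStep A (Occupied A B (y T) D) ((y t).1.a, (y t).2.a) ((y (t + 1)).1.a, σ) := by
  have hmv := h.move t
  rw [hm] at hmv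
  have hA : Proc.procA ∉ D := fun hA => h.dead _ hA t ht hmv.enabled
  obtain ⟨⟨⟨g, hg, hsat⟩, _⟩, _⟩ := hmv
  refine ⟨g, hg, ?_⟩
  rintro q (⟨p, hp, rfl⟩ | ⟨r, hr, rfl⟩)
  · rw [← (h.at_eq hp ht).1]
    exact hsat p fun h => hA (h ▸ hp)
  · obtain ⟨i, _, hi⟩ := h.occupied hr ht
    have := hsat (.procB i) (by simp)
    rwa [Global.at, hi] at this

/-- A guard that excludes a contested state can be satisfied only by its sole occupant. The state
must be occupied after the move too, so the mover stays. -/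
theorem localStepB (hAB : OneConjunctive A B) (h : Settled A B y m T D) {t : ℕ} (ht : T ≤ t)
    {i : Fin n} (hm : m t = .procB i) :
    (∀ σ, LocalStep B (Occupied A B (y T) D) ((y t).1.b i, (y t).2.b i)
      ((y (t + 1)).1.b i, σ)) ∨
      ((y t).1.b i ∈ Contested A B (y T) D ∧ (y (t + 1)).1.b i = (y t).1.b i) := by
  have hmv := h.move t
  rw [hm] at hmv
  have hB : Proc.procB i ∉ D := fun hB => h.dead _ hB t ht hmv.enabled
  obtain ⟨⟨g, hg, hsat⟩, _⟩ := hmv.1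
  by_cases hF : Occupied A B (y T) D ⊆ g
  · exact Or.inl fun σ => ⟨g, hg, hF⟩
  · right
    obtain ⟨q, hqF, hqg⟩ := Set.not_subset.1 hF
    obtain ⟨⟨q', rfl⟩, -, -⟩ := hAB g (Or.inr ⟨_, _, _, hg⟩)
    rw [Set.mem_compl_iff, not_not, Set.mem_singleton_iff] at hqg
    subst hqg
    rcases hqF with ⟨p, hp, hpq⟩ | ⟨r, hr, rfl⟩
    · refine absurd ?_ (hsat p fun h => hB (h ▸ hp))
      rw [(h.at_eq hp ht).1, hpq]; rfl
    · have hat : ∀ j, (y t).1.b j = r → j = i := by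
        intro j hj
        by_contra hne
        exact hsat (.procB j) (by simpa using hne) (congrArg Sum.inr hj)
      obtain ⟨j, _, hj⟩ := h.occupied hr ht
      obtain rfl := hat j hj
      obtain ⟨k, _, hk⟩ := h.occupied hr (ht.trans t.le_succ)
      have hkj : k = j := by
        by_contra hne
        have := hmv.state_eq (p' := .procB k) (by simpa using hne)
        exact hne (hat k ((Sum.inr_injective this).symm.trans hk))
      rw [hkj] at hk
      exact ⟨hj ▸ hr, hk.trans hj.symm⟩

theorem profile (hAB : OneConjunctive A B) (h : Settled A B y m T D) (hr : Reach A B (y T))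
    (hD : D.Nonempty) : Profile A B (y T) D := by
  have hstayA : ∀ t, ¬ m t = .procA →
      ((y (t + 1)).1.a, (y (t + 1)).2.a) = ((y t).1.a, (y t).2.a) := fun t ht =>
    Prod.ext (Sum.inl_injective ((h.move t).state_eq (Ne.symm ht)))
      (Sum.inl_injective ((h.move t).input_eq (Ne.symm ht)))
  have hstayB : ∀ i t, ¬ m t = .procB i →
      ((y (t + 1)).1.b i, (y (t + 1)).2.b i) = ((y t).1.b i, (y t).2.b i) := fun i t ht =>
    Prod.ext (Sum.inr_injective ((h.move t).state_eq (Ne.symm ht)))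
      (Sum.inr_injective ((h.move t).input_eq (Ne.symm ht)))
  have hforth : ∀ i, Proc.procB i ∉ D → ∃ σ₀, ∀ᶠ t in atTop, ∀ σ,
      Relation.TransGen (LocalStep B (Occupied A B (y T) D)) (B.init, σ₀) ((y t).1.b i, σ) := by
    intro i hi
    obtain ⟨t₁, ht₁, hinit⟩ := frequently_atTop.1 (h.init _ hi) T
    refine ⟨(y t₁).2.b i, ?_⟩
    have hinit : (y t₁).1.b i = B.init := hinit
    have := eventually_transGen (u := fun t => ((y t).1.b i, (y t).2.b i))
      (mv := fun t => m t = .procB i) (C := fun r => r ∈ Contested A B (y T) D)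
      (hstayB i) (fun t ht hm => h.localStepB hAB ht hm) ht₁
      (fun hC => Contested.ne_init hAB hC hinit) (h.live _ hi)
    rwa [hinit] at this
  refine ⟨hr, hD, fun p hp g hg => h.blocked hAB hp hg, fun hA => ⟨h.start hA, ?_⟩,
    fun i hi => ?_, fun r hr => h.occupied hr le_rfl⟩
  · have := eventually_transGen (u := fun t => ((y t).1.a, (y t).2.a))
      (mv := fun t => m t = .procA) (C := fun _ => False)
      hstayA (fun t ht hm => Or.inl fun σ => h.localStepA ht hm σ) le_rfl id (h.live _ hA)
    obtain ⟨t, h1, h2⟩ := ((h.init _ hA).and_eventually this).exists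
    have h1 : (y t).1.a = A.init := h1
    have := h2 (y T).2.a
    rwa [h1, h.start hA] at this
  · obtain ⟨σ₀, hσ₀⟩ := hforth i hi
    have hcyc : ∀ σ, Relation.TransGen (LocalStep B (Occupied A B (y T) D))
        (B.init, σ₀) (B.init, σ) := by
      obtain ⟨t, h1, h2⟩ := ((h.init _ hi).and_eventually hσ₀).exists
      have h1 : (y t).1.b i = B.init := h1
      rwa [h1] at h2
    refine ⟨σ₀, hcyc σ₀, fun r hr => ?_⟩
    -- Contested states are always occupied and there are finitely many copies, so one copy holds
    -- `r` infinitely often.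
    obtain ⟨j, hj⟩ : ∃ j, ∃ᶠ t in atTop, Proc.procB j ∉ D ∧ (y t).1.b j = r := by
      by_contra hcon
      have := eventually_all.2 fun j => not_frequently.1 (not_exists.1 hcon j)
      obtain ⟨t, h1, h2⟩ := (this.and (eventually_ge_atTop T)).exists
      obtain ⟨j, hj⟩ := h.occupied hr h2
      exact h1 j hj
    obtain ⟨t₁, ht₁, hjD, hjr⟩ := frequently_atTop.1 hj T
    constructor
    · obtain ⟨σ₁, hσ₁⟩ := hforth j hjD
      obtain ⟨t, h1, h2⟩ := (hj.and_eventually hσ₁).exists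
      rw [h1.2] at h2
      -- Copy `i` returns to `init` with the input `σ₁` that `j` had there, then imitates `j`.
      exact fun σ => (hcyc σ₁).trans (h2 σ)
    · obtain ⟨t₂, ht₂, hinit⟩ := frequently_atTop.1 (h.init _ hjD) t₁
      have hinit : (y t₂).1.b j = B.init := hinit
      obtain ⟨ι, hι⟩ := exists_transGen_of_ne (u := fun t => ((y t).1.b j, (y t).2.b j))
        (mv := fun t => m t = .procB j) (C := fun r => r ∈ Contested A B (y T) D)
        (hstayB j) (fun t ht hm => h.localStepB hAB ht hm) ht₁ ht₂
        (by
          simp only [hinit, hjr]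
          exact (Contested.ne_init hAB hr).symm)
      simp only [hjr, hinit] at hι
      exact ⟨ι, hι σ₀⟩

end Settled

theorem HasLocalDeadlock.exists_profile (hAB : OneConjunctive A B) (h : HasLocalDeadlock A B n) :
    ∃ (x : SI QA SA QB SB n) (D : Set (Proc n)), Profile A B x D ∧ Dᶜ.Nonempty := by
  obtain ⟨c, ⟨h0, hnext⟩, hfair, hinit, p₀, hp₀⟩ := h
  choose m hm hstep hin using hnext
  let y : ℕ → SI QA SA QB SB n := fun t => ((c t).state, (c t).input)
  have hmove : ∀ t, Move A B (m t) (y t) (y (t + 1)) := fun t => ⟨hstep t, hin t⟩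
  let D : Set (Proc n) := {p | LocallyDeadlocked A B c p}
  have hlive : ∀ p ∉ D, ∃ᶠ t in atTop, (c t).mover = some p := by
    intro p hp
    exact hfair p hp
  have hreach : ∀ t, Reach A B (y t) := by
    intro t
    induction t with
    | zero => exact ⟨y 0, h0, Relation.ReflTransGen.refl⟩
    | succ t ih => exact ih.trans (Relation.ReflTransGen.single ⟨_, hmove t⟩)
  have hdead : ∀ᶠ t in atTop, ∀ p, p ∈ D → ¬ Enabled A B (y t).1 (y t).2 p := by
    refine eventually_all.2 fun p => ?_
    by_cases hp : p ∈ D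
    · exact (show LocallyDeadlocked A B c p from hp).mono fun t h _ => h
    · exact Eventually.of_forall fun t h => absurd h hp
  obtain ⟨T₀, hT₀⟩ := eventually_atTop.1 hdead
  -- A live `A` needs a cycle based at the chosen configuration itself, so the moment is postponed
  -- to one of its visits to `init`.
  obtain ⟨T, hT, hstart⟩ : ∃ T, T₀ ≤ T ∧ (Proc.procA ∉ D → (y T).1.a = A.init) := by
    by_cases hA : Proc.procA ∈ D
    · exact ⟨T₀, le_rfl, fun h => absurd hA h⟩
    · obtain ⟨T, hT, h⟩ := frequently_atTop.1 (hinit _ (hlive _ hA)) T₀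
      exact ⟨T, hT, fun _ => h⟩
  have hset : Settled A B y m T D := by
    refine ⟨hmove, fun p hp t ht => hT₀ t (hT.trans ht) p hp, fun p hp => ?_,
      fun p hp => hinit p (hlive p hp), hstart⟩
    exact (hlive p hp).mono fun t h => by simpa [hm] using h
  refine ⟨y T, D, hset.profile hAB (hreach T) ⟨p₀, hp₀⟩, ⟨m T, fun h => ?_⟩⟩
  exact hT₀ T hT _ h (hmove T).enabled

end Profile
end GuardedProtocol

namespace GuardedProtocol

/-! ### Executing a local path while all other processes rest -/

section SoloMoves

variable {QA SA QB SB : Type*} {n : ℕ}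
variable {A : Template QA SA (QA ⊕ QB)} {B : Template QB SB (QA ⊕ QB)}

/-- Moves between configurations that satisfy `Inv`. -/
def MoveIn (A : Template QA SA (QA ⊕ QB)) (B : Template QB SB (QA ⊕ QB))
    (Inv : SI QA SA QB SB n → Prop) (p : Proc n) (x y : SI QA SA QB SB n) : Prop :=
  Move A B p x y ∧ Inv x ∧ Inv y

/-- A state that belongs to every guard containing `F`. -/
def Safe (A : Template QA SA (QA ⊕ QB)) (B : Template QB SB (QA ⊕ QB)) (F : Set (QA ⊕ QB))
    (q : QA ⊕ QB) : Prop :=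
  q ∈ F ∨ q = Sum.inl A.init ∨ q = Sum.inr B.init

theorem reflTransGen_of_first_move {S : Proc n → SI QA SA QB SB n → SI QA SA QB SB n → Prop}
    {p : Proc n} {x y : SI QA SA QB SB n}
    (h : ∃ w, S p x w ∧ Relation.ReflTransGen (Edge S) w y) :
    Relation.ReflTransGen (Edge S) x y :=
  let ⟨_, h1, h2⟩ := h
  Relation.ReflTransGen.head ⟨p, h1⟩ h2

/-- The others rest in states that every guard on the path admits. The first move is singled out
because the loops of the run must exhibit a move out of `init`. -/
theorem exists_solo_A (hAB : OneConjunctive A B) {F : Set (QA ⊕ QB)}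
    {Inv : SI QA SA QB SB n → Prop} {z : SI QA SA QB SB n}
    (hsafe : ∀ p, p ≠ .procA → Safe A B F (z.1.at p)) (hInv : ∀ q σ, Inv (setA z q σ))
    {a b : QA × SA} (h : Relation.TransGen (LocalStep A F) a b) :
    ∃ w, MoveIn A B Inv .procA (setA z a.1 a.2) w ∧
      Relation.ReflTransGen (Edge (MoveIn A B Inv)) w (setA z b.1 b.2) := by
  have hone : ∀ a b, LocalStep A F a b →
      MoveIn A B Inv .procA (setA z a.1 a.2) (setA z b.1 b.2) := by
    rintro a b ⟨g, hg, hF⟩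
    have hi := (hAB g (Or.inl ⟨_, _, _, hg⟩)).2
    refine ⟨move_setA (x := setA z a.1 a.2) b.2 hg ?_, hInv _ _, hInv _ _⟩
    rintro (_ | j) hp
    · exact absurd rfl hp
    · rcases hsafe _ hp with h | h | h
      · exact hF h
      · simp [Global.at] at h
      · exact Set.mem_of_eq_of_mem h hi.2
  induction h using Relation.TransGen.head_induction_on with
  | single h => exact ⟨_, hone _ _ h, Relation.ReflTransGen.refl⟩
  | head h _ ih => exact ⟨_, hone _ _ h, reflTransGen_of_first_move ih⟩

theorem setB_setB (z : SI QA SA QB SB n) (j : Fin n) (q q' : QB) (σ σ' : SB) :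
    setB (setB z j q σ) j q' σ' = setB z j q' σ' := by
  simp [setB]

theorem setB_self (z : SI QA SA QB SB n) (j : Fin n) : setB z j (z.1.b j) (z.2.b j) = z := by
  simp [setB]

theorem setB_comm (z : SI QA SA QB SB n) {j j' : Fin n} (hj : j ≠ j') (q q' : QB) (σ σ' : SB) :
    setB (setB z j q σ) j' q' σ' = setB (setB z j' q' σ') j q σ := by
  simp [setB, Function.update_comm hj]

theorem exists_solo_B (hAB : OneConjunctive A B) {F : Set (QA ⊕ QB)}
    {Inv : SI QA SA QB SB n → Prop} {z : SI QA SA QB SB n} {j : Fin n}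
    (hsafe : ∀ p, p ≠ .procB j → Safe A B F (z.1.at p)) (hInv : ∀ q σ, Inv (setB z j q σ))
    {a b : QB × SB} (h : Relation.TransGen (LocalStep B F) a b) :
    ∃ w, MoveIn A B Inv (.procB j) (setB z j a.1 a.2) w ∧
      Relation.ReflTransGen (Edge (MoveIn A B Inv)) w (setB z j b.1 b.2) := by
  have hone : ∀ a b, LocalStep B F a b →
      MoveIn A B Inv (.procB j) (setB z j a.1 a.2) (setB z j b.1 b.2) := by
    rintro a b ⟨g, hg, hF⟩
    have hi := (hAB g (Or.inr ⟨_, _, _, hg⟩)).2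
    refine ⟨?_, hInv _ _, hInv _ _⟩
    rw [← setB_setB z j a.1 b.1 a.2 b.2]
    refine move_setB b.2 (by simpa [setB] using hg) fun p hp => ?_
    have hat : (setB z j a.1 a.2).1.at p = z.1.at p := by
      cases p with
      | procA => rfl
      | procB i =>
        have : i ≠ j := fun h => hp (by rw [h])
        simp [setB, Global.at, this]
    rw [hat]
    rcases hsafe _ hp with h | h | h
    · exact hF h
    · exact Set.mem_of_eq_of_mem h hi.1
    · exact Set.mem_of_eq_of_mem h hi.2
  induction h using Relation.TransGen.head_induction_on with
  | single h => exact ⟨_, hone _ _ h, Relation.ReflTransGen.refl⟩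
  | head h _ ih => exact ⟨_, hone _ _ h, reflTransGen_of_first_move ih⟩

theorem safe_setB {F : Set (QA ⊕ QB)} {z : SI QA SA QB SB n} (j : Fin n) {q : QB} (σ : SB)
    (hz : ∀ p, Safe A B F (z.1.at p)) (hq : Safe A B F (Sum.inr q)) (p : Proc n) :
    Safe A B F ((setB z j q σ).1.at p) := by
  cases p with
  | procA => exact hz .procA
  | procB i =>
    by_cases h : i = j
    · subst h; simpa [setB, Global.at] using hq
    · simpa [setB, Global.at, h] using hz (.procB i)

end SoloMoves

/-! ### Imitating a profile in a system of another size -/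

section Layout

variable {QA SA QB SB : Type*} {n N f : ℕ}

/-- The roles of the processes of a system with `N` copies of `B` that imitates the deadlock of a
profile: copies of disabled processes, one process for each contested state, and `f` processes
that are initial at rest. -/
structure Layout (A : Template QA SA (QA ⊕ QB)) (B : Template QB SB (QA ⊕ QB))
    (x : SI QA SA QB SB n) (D : Set (Proc n)) (N f : ℕ) where
  dead : Finset (Fin n)
  role : Fin N ≃ dead ⊕ (Contested A B x D ⊕ Fin f)
  first : Contested A B x D ⊕ Fin f → SB
  last : Contested A B x D → SB
  mem_dead : ∀ i ∈ dead, Proc.procB i ∈ D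
  -- Here `p` is the process to be blocked: the copy kept must differ from it. Initial states block
  -- nothing and need no copy.
  sel : ∀ i, Proc.procB i ∈ D → x.1.b i ≠ B.init → ∀ p, p ≠ Proc.procB i →
    ∃ i' ∈ dead, Proc.procB i' ≠ p ∧ x.1.b i' = x.1.b i
  cycle : ∀ z,
    Relation.TransGen (LocalStep B (Occupied A B x D)) (B.init, first z) (B.init, first z) ∧
    ∀ r ∈ Contested A B x D,
      (∀ σ, Relation.TransGen (LocalStep B (Occupied A B x D)) (B.init, first z) (r, σ)) ∧
      ∃ σ, Relation.TransGen (LocalStep B (Occupied A B x D)) (r, σ) (B.init, first z)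
  -- A post whose state is also held by a dead copy imitates that copy, including its input, and is
  -- disabled; any other post can return to `init`.
  last_spec : ∀ r : Contested A B x D, (∃ d ∈ dead, x.1.b d = r ∧ last r = x.2.b d) ∨
    ((∀ d ∈ dead, x.1.b d ≠ r) ∧
      Relation.TransGen (LocalStep B (Occupied A B x D)) (r.1, last r) (B.init, first (.inl r)))
  -- Without a filler nobody can relieve a live post, so all posts must be disabled ones.
  filler : f = 0 → ∀ r ∈ Contested A B x D, ∃ d ∈ dead, x.1.b d = r

variable {A : Template QA SA (QA ⊕ QB)} {B : Template QB SB (QA ⊕ QB)}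

namespace Layout

variable {x : SI QA SA QB SB n} {D : Set (Proc n)} (l : Layout A B x D N f)

open Classical in
/-- The configuration in which exactly the processes for the contested states in `s` have taken
their positions. -/
noncomputable def config (s : Set (Contested A B x D)) : SI QA SA QB SB N :=
  (⟨x.1.a, fun j => Sum.elim (fun d : l.dead => x.1.b d)
      (Sum.elim (fun r => if r ∈ s then r.1 else B.init) fun _ => B.init) (l.role j)⟩,
    ⟨x.2.a, fun j => Sum.elim (fun d : l.dead => x.2.b d)
      (Sum.elim (fun r => if r ∈ s then l.last r else l.first (.inl r))
        fun k => l.first (.inr k)) (l.role j)⟩)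

/-- The disabled processes. -/
def disabled : Set (Proc N) :=
  {p | match p with
    | .procA => Proc.procA ∈ D
    | .procB j => (∃ d, l.role j = .inl d) ∨
        ∃ r, l.role j = .inr (.inl r) ∧ ∃ d ∈ l.dead, x.1.b d = r}

/-- The disabled processes have their positions, and all contested states are occupied. -/
structure Inv (z : SI QA SA QB SB N) : Prop where
  eqA : Proc.procA ∈ D → z.1.a = x.1.a ∧ z.2.a = x.2.a
  eq_dead : ∀ j d, l.role j = .inl d → z.1.b j = x.1.b d ∧ z.2.b j = x.2.b d
  eq_last : ∀ j r, l.role j = .inr (.inl r) → (∃ d ∈ l.dead, x.1.b d = r) →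
    z.1.b j = r ∧ z.2.b j = l.last r
  occupied : ∀ r ∈ Contested A B x D, (∀ d ∈ l.dead, x.1.b d ≠ r) → ∃ j, z.1.b j = r

theorem inv_config : l.Inv (l.config Set.univ) where
  eqA _ := ⟨rfl, rfl⟩
  eq_dead j d h := by simp [config, h]
  eq_last j r h _ := by simp [config, h]
  occupied r hr _ := ⟨l.role.symm (.inr (.inl ⟨r, hr⟩)), by simp [config]⟩

variable {l}

theorem Inv.setA {z : SI QA SA QB SB N} (h : l.Inv z) (hA : Proc.procA ∉ D) (q : QA) (σ : SA) :
    l.Inv (setA z q σ) :=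
  ⟨fun h => absurd h hA, h.eq_dead, h.eq_last, h.occupied⟩

theorem Inv.setB {z : SI QA SA QB SB N} (h : l.Inv z) {j : Fin N}
    (hj : Proc.procB j ∉ l.disabled)
    (hocc : ∀ r ∈ Contested A B x D, (∀ d ∈ l.dead, x.1.b d ≠ r) →
      ∃ j', j' ≠ j ∧ z.1.b j' = r) (q : QB) (σ : SB) :
    l.Inv (setB z j q σ) := by
  refine ⟨h.eqA, fun j' d h' => ?_, fun j' r h' hr => ?_, fun r hr hn => ?_⟩
  · have : j' ≠ j := by rintro rfl; exact hj (Or.inl ⟨d, h'⟩)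
    simpa [GuardedProtocol.setB, this] using h.eq_dead j' d h'
  · have : j' ≠ j := by rintro rfl; exact hj (Or.inr ⟨r, h', hr⟩)
    simpa [GuardedProtocol.setB, this] using h.eq_last j' r h' hr
  · obtain ⟨j', hne, hj'⟩ := hocc r hr hn
    exact ⟨j', by simpa [GuardedProtocol.setB, hne] using hj'⟩

theorem Inv.not_enabled (hAB : OneConjunctive A B) (hP : Profile A B x D)
    {z : SI QA SA QB SB N} (h : l.Inv z) {p : Proc N} (hp : p ∈ l.disabled) :
    ¬ Enabled A B z.1 z.2 p := by
  -- `p₀` is the dead process of the profile that `p` imitates; both have the same guards.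
  obtain ⟨p₀, hp₀, hs, hi, hA, hB⟩ : ∃ p₀ ∈ D, z.1.at p = x.1.at p₀ ∧ z.2.at p = x.2.at p₀ ∧
      (p = .procA → p₀ = .procA) ∧
      ∀ d, p = .procB (l.role.symm (.inl d)) → p₀ = .procB d.1 := by
    cases p with
    | procA =>
      exact ⟨.procA, hp, congrArg Sum.inl (h.eqA hp).1, congrArg Sum.inl (h.eqA hp).2,
        fun _ => rfl, fun d hd => by simp at hd⟩
    | procB j =>
      rcases hp with ⟨d, hd⟩ | ⟨r, hr, hex⟩
      · refine ⟨.procB d, l.mem_dead d d.2, congrArg Sum.inr (h.eq_dead j d hd).1,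
          congrArg Sum.inr (h.eq_dead j d hd).2, fun h => by simp at h, fun d' hd' => ?_⟩
        rw [Proc.procB.injEq] at hd'
        rw [hd', Equiv.apply_symm_apply, Sum.inl.injEq] at hd
        rw [hd]
      · obtain ⟨h1, h2⟩ := h.eq_last j r hr hex
        rcases l.last_spec r with ⟨d, hd, hdr, hlast⟩ | ⟨hn, _⟩
        · refine ⟨.procB d, l.mem_dead d hd, congrArg Sum.inr (h1.trans hdr.symm),
            congrArg Sum.inr (h2.trans hlast), fun h => by simp at h, fun d' hd' => ?_⟩
          rw [Proc.procB.injEq] at hd'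
          rw [hd', Equiv.apply_symm_apply] at hr
          simp at hr
        · obtain ⟨d, hd, hdr⟩ := hex
          exact absurd hdr (hn d hd)
  intro hen
  obtain ⟨g, hg, hsat⟩ := enabled_iff.1 hen
  have hg₀ := hg.congr hs hi
  obtain ⟨q, rfl, hqA, hqB⟩ := hAB.of_hasGuard hg₀
  suffices hex : ∃ p', p' ≠ p ∧ z.1.at p' = q by
    obtain ⟨p', hne, hp'⟩ := hex
    exact hsat p' hne hp'
  rcases hP.blocked p₀ hp₀ _ hg₀ with ⟨p', hp', hne, hq⟩ | ⟨r, hr, hq⟩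
  · rw [Set.mem_compl_iff, not_not, Set.mem_singleton_iff] at hq
    subst hq
    cases p' with
    | procA => exact ⟨.procA, fun h => hne (hA h.symm).symm, congrArg Sum.inl (h.eqA hp').1⟩
    | procB i =>
      obtain ⟨i', hi', hne', hs'⟩ := l.sel i hp' (fun h => hqB (congrArg Sum.inr h)) p₀ hne.symm
      refine ⟨.procB (l.role.symm (.inl ⟨i', hi'⟩)), fun h => hne' (hB _ h.symm).symm, ?_⟩
      exact congrArg Sum.inr ((h.eq_dead _ ⟨i', hi'⟩ (by simp)).1.trans hs')
  · rw [compl_inj_iff, Set.singleton_eq_singleton_iff] at hq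
    subst hq
    by_cases hset : ∃ d ∈ l.dead, x.1.b d = r
    -- Both the post and a dead copy are in `r`, so one of them differs from `p`.
    · by_cases hpr : p = .procB (l.role.symm (.inr (.inl ⟨r, hr⟩)))
      · obtain ⟨d, hd, hdr⟩ := hset
        refine ⟨.procB (l.role.symm (.inl ⟨d, hd⟩)), ?_, ?_⟩
        · rw [hpr]; simp
        · exact congrArg Sum.inr ((h.eq_dead _ ⟨d, hd⟩ (by simp)).1.trans hdr)
      · exact ⟨_, Ne.symm hpr, congrArg Sum.inr (h.eq_last _ ⟨r, hr⟩ (by simp) hset).1⟩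
    · push Not at hset
      -- The occupant is not `p`: a disabled copy of `B` has the state of some dead copy, and none
      -- of these is in `r`.
      obtain ⟨j, hj⟩ := h.occupied r hr hset
      refine ⟨.procB j, ?_, congrArg Sum.inr hj⟩
      rintro rfl
      rcases hp with ⟨d, hd⟩ | ⟨r', hr', hex⟩
      · exact hset d d.2 ((h.eq_dead j d hd).1.symm.trans hj)
      · obtain ⟨d, hd, hdr⟩ := hex
        exact hset d hd (hdr.trans ((h.eq_last j r' hr' ⟨d, hd, hdr⟩).1.symm.trans hj))

variable (l)

theorem safe_config (hP : Profile A B x D) (s : Set (Contested A B x D)) (p : Proc N) :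
    Safe A B (Occupied A B x D) ((l.config s).1.at p) := by
  classical
  cases p with
  | procA =>
    by_cases hA : Proc.procA ∈ D
    · exact Or.inl (Or.inl ⟨_, hA, rfl⟩)
    · exact Or.inr (Or.inl (congrArg Sum.inl (hP.cycleA hA).1))
  | procB j =>
    simp only [config, Global.at]
    rcases l.role j with d | r | k
    · exact Or.inl (Or.inl ⟨.procB d, l.mem_dead d d.2, rfl⟩)
    · by_cases hr : r ∈ s
      · simp only [Sum.elim_inr, Sum.elim_inl, hr, if_true]
        exact Or.inl (Or.inr ⟨r, r.2, rfl⟩)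
      · simp only [Sum.elim_inr, Sum.elim_inl, hr, if_false]
        exact Or.inr (Or.inr rfl)
    · exact Or.inr (Or.inr rfl)

theorem config_insert {s : Set (Contested A B x D)} {r : Contested A B x D} :
    setB (l.config s) (l.role.symm (.inr (.inl r))) r (l.last r) = l.config (insert r s) := by
  classical
  simp only [setB, config, Prod.mk.injEq, Global.mk.injEq, true_and]
  constructor <;>
  · funext j
    by_cases hj : j = l.role.symm (.inr (.inl r))
    · subst hj; simp
    · rw [Function.update_of_ne hj]
      have hj' : l.role j ≠ .inr (.inl r) := fun h => hj (by simp [← h])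
      rcases hr : l.role j with d | r' | k
      · rfl
      · have : r' ≠ r := fun h => hj' (by rw [hr, h])
        simp [this]
      · rfl

/-- Forgetting all copies of `B` but the selected dead ones leaves everyone else at `init`; the
posts are then taken one by one through local paths. -/
theorem reach_config [Finite QB] (hAB : OneConjunctive A B) (hP : Profile A B x D) :
    Reach A B (l.config Set.univ) := by
  classical
  have h0 : Reach A B (l.config ∅) := by
    have := hP.reach.pull hAB (N := N)
      (φ := fun j => Sum.elim (fun d => some d.1) (fun _ => none) (l.role j))
      (fun j => Sum.elim (fun d : l.dead => x.2.b d) l.first (l.role j)) (by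
        intro j j' i h h'
        apply l.role.injective
        rcases hj : l.role j with d | z <;> rcases hj' : l.role j' with d' | z' <;>
          simp only [hj, hj', Sum.elim_inl, Sum.elim_inr, Option.some.injEq, reduceCtorEq] at h h'
        rw [Subtype.ext (h.trans h'.symm)])
    convert this using 1
    simp only [GuardedProtocol.pull, config, Prod.mk.injEq, Global.mk.injEq, true_and]
    constructor <;>
    · funext j
      rcases l.role j with d | r | k <;> simp
  suffices h : ∀ s : Set (Contested A B x D), Reach A B (l.config s) from h _
  intro s
  induction s, Set.toFinite s using Set.Finite.induction_on with
  | empty => exact h0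
  | @insert r s hr _ ih =>
    refine ih.trans ?_
    have hsolo := exists_solo_B hAB (F := Occupied A B x D) (Inv := fun _ => True)
      (z := l.config s) (j := l.role.symm (.inr (.inl r))) (fun p _ => l.safe_config hP s p)
      (fun _ _ => trivial) (((l.cycle (.inl r)).2 r r.2).1 (l.last r))
    rw [l.config_insert] at hsolo
    have hself : setB (l.config s) (l.role.symm (.inr (.inl r))) B.init (l.first (.inl r)) =
        l.config s := by
      conv_rhs => rw [← setB_self (l.config s) (l.role.symm (.inr (.inl r)))]
      simp [config, hr]
    simp only [hself] at hsolo
    exact Relation.ReflTransGen.mono (fun a b ⟨p, h⟩ => ⟨p, h.1⟩) _ _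
      (reflTransGen_of_first_move hsolo)

theorem hasGlobalDeadlock (l : Layout A B x D N f) [Finite QB] (hAB : OneConjunctive A B) (hP : Profile A B x D)
    (hf : f = 0) (hA : Proc.procA ∈ D) : HasGlobalDeadlock A B N := by
  refine hasGlobalDeadlock_iff.2 ⟨_, l.reach_config hAB hP, fun p =>
    l.inv_config.not_enabled hAB hP ?_⟩
  cases p with
  | procA => exact hA
  | procB j =>
    rcases hj : l.role j with d | r | k
    · exact Or.inl ⟨d, hj⟩
    · exact Or.inr ⟨r, hj, l.filler hf r r.2⟩
    · subst hf; exact k.elim0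

theorem hasLocalDeadlock [Finite QB] (hAB : OneConjunctive A B) (hP : Profile A B x D)
    (hlive : 0 < f ∨ Proc.procA ∉ D) (hdead : l.dead.Nonempty ∨ Proc.procA ∈ D) :
    HasLocalDeadlock A B N := by
  classical
  have hnd : ∀ j k, l.role j = .inr (.inr k) → Proc.procB j ∉ l.disabled := by
    rintro j k hj (⟨d, hd⟩ | ⟨r, hr, _⟩)
    · simp [hj] at hd
    · simp [hj] at hr
  set c := l.config Set.univ with hc
  have hsafe : ∀ p, Safe A B (Occupied A B x D) (c.1.at p) := l.safe_config hP Set.univ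
  have hcr : ∀ r : Contested A B x D, c.1.b (l.role.symm (.inr (.inl r))) = r := fun r => by
    simp [hc, config]
  have hinvk : ∀ j k, l.role j = .inr (.inr k) → ∀ q σ, l.Inv (setB c j q σ) := by
    intro j k hj q σ
    refine l.inv_config.setB (hnd j k hj) (fun r hr _ => ?_) q σ
    refine ⟨l.role.symm (.inr (.inl ⟨r, hr⟩)), ?_, hcr ⟨r, hr⟩⟩
    rintro rfl
    simp at hj
  have hselfk : ∀ j k, l.role j = .inr (.inr k) → setB c j B.init (l.first (.inr k)) = c := by
    intro j k hj
    conv_rhs => rw [← setB_self c j]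
    simp [hc, config, hj]
  refine hasLocalDeadlock_of_cycles (l.reach_config hAB hP) l.disabled l.Inv
    (fun z hz p hp => hz.not_enabled hAB hP hp) ?_ ?_ ?_
  · rcases hdead with ⟨d, hd⟩ | hA
    · exact ⟨.procB (l.role.symm (.inl ⟨d, hd⟩)), Or.inl ⟨⟨d, hd⟩, by simp⟩⟩
    · exact ⟨.procA, hA⟩
  · rcases hlive with hf | hA
    · exact ⟨.procB (l.role.symm (.inr (.inr ⟨0, hf⟩))), hnd _ ⟨0, hf⟩ (by simp)⟩
    · exact ⟨.procA, hA⟩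
  · rintro (_ | j) hp
    · have hA : Proc.procA ∉ D := hp
      obtain ⟨hinit, hcyc⟩ := hP.cycleA hA
      obtain ⟨w, h1, h2⟩ := exists_solo_A hAB (z := c) (fun p _ => hsafe p)
        (fun q σ => l.inv_config.setA hA q σ) hcyc
      have hself : setA c A.init x.2.a = c := by
        rw [← hinit]; rfl
      rw [hself] at h1 h2
      exact ⟨c, w, Relation.ReflTransGen.refl, h1, hinit, h2⟩
    · rcases hj : l.role j with d | r | k
      · exact absurd (Or.inl ⟨d, hj⟩) hp
      · rcases l.last_spec r with ⟨d, hd, hdr, _⟩ | ⟨hn, hback⟩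
        · exact absurd (Or.inr ⟨r, hj, d, hd, hdr⟩) hp
        · have hf : 0 < f := by
            rcases Nat.eq_zero_or_pos f with hf | hf
            · obtain ⟨d, hd, hdr⟩ := l.filler hf r r.2
              exact absurd hdr (hn d hd)
            · exact hf
          obtain ⟨j₀, hj₀⟩ : ∃ j₀, l.role j₀ = .inr (.inr ⟨0, hf⟩) :=
            ⟨l.role.symm (.inr (.inr ⟨0, hf⟩)), by simp⟩
          have hne : j ≠ j₀ := by rintro rfl; simp [hj] at hj₀
          have hjr : j = l.role.symm (.inr (.inl r)) := by simp [← hj]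
          -- Relief of a live post: the filler `j₀` goes to `r`, then `j` returns to `init`, leaves
          -- it again for `r`, and `j₀` goes home. The state `r` is occupied throughout.
          obtain ⟨hgo, ι, hret⟩ := (l.cycle (.inr ⟨0, hf⟩)).2 r r.2
          have hS1 := reflTransGen_of_first_move (exists_solo_B hAB (z := c) (j := j₀)
            (fun p _ => hsafe p) (hinvk j₀ _ hj₀) (hgo ι))
          have hS4 := reflTransGen_of_first_move (exists_solo_B hAB (z := c) (j := j₀)
            (fun p _ => hsafe p) (hinvk j₀ _ hj₀) hret)
          simp only [hselfk j₀ _ hj₀] at hS1 hS4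
          have hinv' : ∀ q σ, l.Inv (setB (setB c j₀ r ι) j q σ) := by
            refine (hinvk j₀ _ hj₀ r ι).setB hp fun r' hr' _ => ?_
            by_cases hrr : r' = r
            · exact ⟨j₀, hne.symm, by simp [setB, hrr]⟩
            · have h1 : l.role.symm (.inr (.inl ⟨r', hr'⟩)) ≠ j := by
                rw [hjr]
                simpa using fun h => hrr (congrArg Subtype.val h)
              have h2 : l.role.symm (.inr (.inl ⟨r', hr'⟩)) ≠ j₀ := by
                rintro rfl; simp at hj₀
              refine ⟨_, h1, ?_⟩
              simpa [setB, h2] using hcr ⟨r', hr'⟩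
          have hsafe' := safe_setB j₀ ι hsafe
            (Or.inl (Or.inr ⟨r.1, r.2, rfl⟩) : Safe A B (Occupied A B x D) (Sum.inr r.1))
          have hselfj : setB (setB c j₀ r ι) j r (l.last r) = setB c j₀ r ι := by
            rw [setB_comm _ hne.symm]
            congr 1
            conv_rhs => rw [← setB_self c j]
            simp [hc, config, hj]
          have hS2 := reflTransGen_of_first_move (exists_solo_B hAB (j := j)
            (fun p _ => hsafe' p) hinv' hback)
          obtain ⟨w, h1, h2⟩ := exists_solo_B hAB (j := j)
            (fun p _ => hsafe' p) hinv' (((l.cycle (.inl r)).2 r r.2).1 (l.last r))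
          simp only [hselfj] at hS2 h2
          exact ⟨_, w, hS1.trans hS2, h1, by simp [AtInit, setB], h2.trans hS4⟩
      · obtain ⟨w, h1, h2⟩ := exists_solo_B hAB (z := c) (j := j) (fun p _ => hsafe p)
          (hinvk j k hj) (l.cycle (.inr k)).1
        simp only [hselfk j k hj] at h1 h2
        exact ⟨c, w, Relation.ReflTransGen.refl, h1, by simp [AtInit, hc, config, hj], h2⟩

end Layout
end Layout
end GuardedProtocol

namespace GuardedProtocol

/-! ### Counting the processes needed, and the bounds -/

section Counting

variable {QA SA QB SB : Type*} {n N f : ℕ}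
variable {A : Template QA SA (QA ⊕ QB)} {B : Template QB SB (QA ⊕ QB)}

/-- Keep two elements of `E`, or all if there are fewer, for each state other than `q₀`. A state in
`R` has at most one, so together with its entry in `R` it stays within the quota of two, and falls
below it if nothing was kept there. -/
theorem exists_selection [Finite QB] (E : Finset (Fin n)) (s : Fin n → QB) (q₀ : QB) (R : Set QB)
    (hR₀ : q₀ ∉ R) (hR : ∀ r ∈ R, ∀ i ∈ E, ∀ j ∈ E, s i = r → s j = r → i = j) :
    ∃ dead ⊆ E,
      (∀ i ∈ E, s i ≠ q₀ → ∀ p, p ≠ Proc.procB i →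
        ∃ i' ∈ dead, Proc.procB i' ≠ p ∧ s i' = s i) ∧
      dead.card + R.ncard ≤ 2 * ({q₀}ᶜ : Set QB).ncard ∧
      ((∃ r ∈ R, ∀ d ∈ dead, s d ≠ r) → dead.card + R.ncard < 2 * ({q₀}ᶜ : Set QB).ncard) := by
  classical
  obtain ⟨_⟩ := nonempty_fintype QB
  have hex : ∀ q, ∃ F ⊆ E.filter (s · = q), F.card = min 2 (E.filter (s · = q)).card := fun q =>
    Finset.exists_subset_card_eq (min_le_right _ _)
  choose F hFE hFc using hex
  have hFs : ∀ q, ∀ i ∈ F q, s i = q := fun q i hi => (Finset.mem_filter.1 (hFE q hi)).2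
  set V := Finset.univ.erase q₀ with hV
  have hdead : (V.biUnion F).card = ∑ q ∈ V, (F q).card := by
    refine Finset.card_biUnion fun q _ q' _ hne => Finset.disjoint_left.2 fun i hi hi' => hne ?_
    rw [← hFs q i hi, ← hFs q' i hi']
  have hRc : R.ncard = ∑ q ∈ V, if q ∈ R then 1 else 0 := by
    rw [Finset.sum_boole, Nat.cast_id, ← Set.ncard_coe_finset]
    congr 1
    ext q
    simp only [hV, Finset.coe_filter, Finset.mem_erase, Finset.mem_univ, and_true,
      Set.mem_ofPred_eq]
    exact ⟨fun h => ⟨fun h' => hR₀ (h' ▸ h), h⟩, fun h => h.2⟩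
  have hk : 2 * ({q₀}ᶜ : Set QB).ncard = ∑ q ∈ V, 2 := by
    rw [Finset.sum_const, smul_eq_mul, mul_comm, ← Set.ncard_coe_finset]
    congr 2
    ext q
    simp [hV]
  have hle : ∀ q ∈ V, (F q).card + (if q ∈ R then 1 else 0) ≤ 2 := by
    intro q _
    have h2 : (F q).card ≤ 2 := hFc q ▸ min_le_left _ _
    by_cases hq : q ∈ R
    · have : (F q).card ≤ 1 := Finset.card_le_one.2 fun i hi j hj =>
        hR q hq i (Finset.mem_filter.1 (hFE q hi)).1 j (Finset.mem_filter.1 (hFE q hj)).1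
          (hFs q i hi) (hFs q j hj)
      simp only [hq, if_true]
      omega
    · simpa [hq] using h2
  refine ⟨V.biUnion F, ?_, ?_, ?_, ?_⟩
  · exact Finset.biUnion_subset.2 fun q _ => (hFE q).trans (Finset.filter_subset _ _)
  · intro i hi hne p hp
    have hmem : ∀ i' ∈ F (s i), i' ∈ V.biUnion F := fun i' hi' =>
      Finset.mem_biUnion.2 ⟨s i, by simp [hV, hne], hi'⟩
    -- If `i` was dropped, two others with its state were kept, and at most one of them is `p`.
    by_cases hiF : i ∈ F (s i)
    · exact ⟨i, hmem i hiF, hp.symm, rfl⟩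
    · have hlt : (F (s i)).card < (E.filter (s · = s i)).card :=
        Finset.card_lt_card ((Finset.ssubset_iff_of_subset (hFE _)).2
          ⟨i, by simp [hi], hiF⟩)
      have h2 : 1 < (F (s i)).card := by
        have := hFc (s i)
        omega
      obtain ⟨a, ha, b, hb, hab⟩ := Finset.one_lt_card.1 h2
      by_cases hap : Proc.procB a = p
      · refine ⟨b, hmem b hb, fun hbp => hab ?_, hFs _ b hb⟩
        simpa using hap.trans hbp.symm
      · exact ⟨a, hmem a ha, hap, hFs _ a ha⟩
  · rw [hdead, hRc, ← Finset.sum_add_distrib, hk]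
    exact Finset.sum_le_sum hle
  · rintro ⟨r, hr, hn⟩
    rw [hdead, hRc, ← Finset.sum_add_distrib, hk]
    have hrV : r ∈ V := by
      simp only [hV, Finset.mem_erase, Finset.mem_univ, and_true]
      exact fun h => hR₀ (h ▸ hr)
    refine Finset.sum_lt_sum hle ⟨r, hrV, ?_⟩
    have : F r = ∅ := Finset.eq_empty_of_forall_notMem fun i hi =>
      hn i (Finset.mem_biUnion.2 ⟨r, hrV, hi⟩) (hFs r i hi)
    simp [this, hr]

namespace Profile

variable {x : SI QA SA QB SB n} {D : Set (Proc n)}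

theorem nonempty_layout [Finite QB] (hP : Profile A B x D) (dead : Finset (Fin n))
    (mem_dead : ∀ i ∈ dead, Proc.procB i ∈ D)
    (sel : ∀ i, Proc.procB i ∈ D → x.1.b i ≠ B.init → ∀ p, p ≠ Proc.procB i →
      ∃ i' ∈ dead, Proc.procB i' ≠ p ∧ x.1.b i' = x.1.b i)
    (hN : N = dead.card + ((Contested A B x D).ncard + f))
    (hfB : 0 < f → ∃ i, Proc.procB i ∉ D)
    (hf : f = 0 → ∀ r ∈ Contested A B x D, ∃ d ∈ dead, x.1.b d = r) :
    ∃ l : Layout A B x D N f, l.dead = dead := by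
  classical
  obtain ⟨_⟩ := nonempty_fintype QB
  have hcard : Fintype.card (Fin N) =
      Fintype.card (dead ⊕ (Contested A B x D ⊕ Fin f)) := by
    rw [Fintype.card_sum, Fintype.card_sum, Fintype.card_coe, Fintype.card_fin, Fintype.card_fin,
      hN, ← Nat.card_eq_fintype_card (α := Contested A B x D), Nat.card_coe_set_eq]
  have hlive : ∀ z : Contested A B x D ⊕ Fin f, ∃ i, Proc.procB i ∉ D := by
    rintro (r | k)
    · obtain ⟨i, hi, _⟩ := hP.occupied r r.2
      exact ⟨i, hi⟩
    · exact hfB k.pos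
  choose i hi using hlive
  choose first cycle using fun z => hP.cycleB (i z) (hi z)
  have hlast : ∀ r : Contested A B x D, ∃ σ, (∃ d ∈ dead, x.1.b d = r ∧ σ = x.2.b d) ∨
      ((∀ d ∈ dead, x.1.b d ≠ r) ∧ Relation.TransGen (LocalStep B (Occupied A B x D))
        (r.1, σ) (B.init, first (.inl r))) := by
    intro r
    by_cases h : ∃ d ∈ dead, x.1.b d = r
    · obtain ⟨d, hd, hdr⟩ := h
      exact ⟨_, Or.inl ⟨d, hd, hdr, rfl⟩⟩
    · push Not at h
      obtain ⟨σ, hσ⟩ := ((cycle (.inl r)).2 r r.2).2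
      exact ⟨σ, Or.inr ⟨h, hσ⟩⟩
  choose last last_spec using hlast
  exact ⟨⟨dead, Fintype.equivOfCardEq hcard, first, last, mem_dead, sel, cycle, last_spec, hf⟩, rfl⟩

theorem selection [Finite QB] (hAB : OneConjunctive A B) (x : SI QA SA QB SB n)
    (D : Set (Proc n)) :
    ∃ dead : Finset (Fin n), (∀ i ∈ dead, Proc.procB i ∈ D) ∧
      (∀ i, Proc.procB i ∈ D → x.1.b i ≠ B.init → ∀ p, p ≠ Proc.procB i →
        ∃ i' ∈ dead, Proc.procB i' ≠ p ∧ x.1.b i' = x.1.b i) ∧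
      dead.card + (Contested A B x D).ncard ≤ 2 * ({B.init}ᶜ : Set QB).ncard ∧
      ((∃ r ∈ Contested A B x D, ∀ d ∈ dead, x.1.b d ≠ r) →
        dead.card + (Contested A B x D).ncard < 2 * ({B.init}ᶜ : Set QB).ncard) := by
  classical
  obtain ⟨dead, h1, h2, h3, h4⟩ := exists_selection
    (Finset.univ.filter fun i => Proc.procB i ∈ D) x.1.b B.init (Contested A B x D)
    (fun h => Contested.ne_init hAB h rfl) (by
      rintro r ⟨p, _, _, hn⟩ i hi j hj hir hjr
      have key : ∀ i ∈ Finset.univ.filter fun i => Proc.procB i ∈ D, x.1.b i = r →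
          Proc.procB i = p := by
        intro i hi hir
        by_contra hne
        exact hn _ (by simpa using hi) hne (congrArg Sum.inr hir)
      simpa using (key i hi hir).trans (key j hj hjr).symm)
  exact ⟨dead, fun i hi => by simpa using h1 hi, fun i hi => h2 i (by simpa using hi), h3, h4⟩

theorem contested_eq_empty (hP : Profile A B x D) (hB : ∀ i, Proc.procB i ∈ D) :
    Contested A B x D = ∅ := by
  refine Set.eq_empty_of_forall_notMem fun r hr => ?_
  obtain ⟨i, hi, _⟩ := hP.occupied r hr
  exact hi (hB i)

/-- If all copies of `B` are disabled, then any sufficiently large number of them suffices. -/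
theorem exists_layout_of_forall [Finite QB] (hAB : OneConjunctive A B) (hP : Profile A B x D)
    (hB : ∀ i, Proc.procB i ∈ D) (hN : 2 * ({B.init}ᶜ : Set QB).ncard ≤ N) (hn : N ≤ n) :
    ∃ l : Layout A B x D N 0, l.dead.card = N := by
  have hR := hP.contested_eq_empty hB
  obtain ⟨dead₀, h1, h2, h3, -⟩ := selection hAB x D
  rw [hR, Set.ncard_empty] at h3
  obtain ⟨dead, hsub, hc⟩ := Finset.exists_superset_card_eq (s := dead₀) (n := N) (by omega)
    (by simpa using hn)
  obtain ⟨l, hl⟩ := hP.nonempty_layout (N := N) (f := 0) dead (fun i _ => hB i)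
    (fun i hi hne p hp => by
      obtain ⟨i', hi', h⟩ := h2 i hi hne p hp
      exact ⟨i', hsub hi', h⟩)
    (by rw [hR, Set.ncard_empty, hc]; omega) (fun h => absurd h (lt_irrefl _))
    (fun _ r hr => by rw [hR] at hr; exact hr.elim)
  exact ⟨l, hl ▸ hc⟩

theorem of_global {x : SI QA SA QB SB n} (hx : Reach A B x)
    (hd : ∀ p, ¬ Enabled A B x.1 x.2 p) : Profile A B x Set.univ := by
  have hb : ∀ p g, HasGuard A B x p g → ∃ p', p' ≠ p ∧ x.1.at p' ∉ g := by
    intro p g hg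
    by_contra hcon
    push Not at hcon
    exact hd p (enabled_iff.2 ⟨g, hg, hcon⟩)
  refine ⟨hx, ⟨.procA, trivial⟩, fun p _ g hg => Or.inl ?_, fun h => absurd trivial h,
    fun i h => absurd trivial h, ?_⟩
  · obtain ⟨p', h⟩ := hb p g hg
    exact ⟨p', trivial, h⟩
  · rintro r ⟨p, _, hg, hn⟩
    obtain ⟨p', hne, h⟩ := hb p _ hg
    exact absurd (by simpa using h) (hn p' trivial hne)

/-- The deadlock can become global only if no place is left for a filler and `A` is dead; the quota
is then exhausted, which fixes `N`. -/
theorem deadlock [Finite QB] (hAB : OneConjunctive A B) (hP : Profile A B x D)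
    (hD' : Dᶜ.Nonempty) (hk : 2 ≤ ({B.init}ᶜ : Set QB).ncard)
    (hN : 2 * ({B.init}ᶜ : Set QB).ncard ≤ N) (hn : N ≤ n) :
    HasLocalDeadlock A B N ∨
      (N = 2 * ({B.init}ᶜ : Set QB).ncard ∧ HasGlobalDeadlock A B N) := by
  by_cases hB : ∀ i, Proc.procB i ∈ D
  · left
    obtain ⟨l, hl⟩ := hP.exists_layout_of_forall hAB hB hN hn
    refine l.hasLocalDeadlock hAB hP (Or.inr ?_) (Or.inl (Finset.card_pos.1 (by omega)))
    obtain ⟨p, hp⟩ := hD'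
    cases p with
    | procA => exact hp
    | procB i => exact absurd (hB i) hp
  push Not at hB
  obtain ⟨dead, h1, h2, h3, h4⟩ := selection hAB x D
  -- In this case all dead processes are copies of `B` in `init`, and one is kept by hand as the
  -- deadlocked process. There are at most `|Q_B \ {init}|` posts, so `hk` leaves at least one
  -- filler.
  by_cases hempty : dead = ∅ ∧ Proc.procA ∉ D
  · obtain ⟨rfl, hA⟩ := hempty
    left
    obtain ⟨i, hi⟩ : ∃ i, Proc.procB i ∈ D := by
      obtain ⟨p, hp⟩ := hP.dead_nonempty
      cases p with
      | procA => exact absurd hp hA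
      | procB i => exact ⟨i, hp⟩
    have hR : (Contested A B x D).ncard ≤ ({B.init}ᶜ : Set QB).ncard :=
      Set.ncard_le_ncard (fun r hr => Contested.ne_init hAB hr) (Set.toFinite _)
    obtain ⟨l, hl⟩ := hP.nonempty_layout (N := N) (f := N - 1 - (Contested A B x D).ncard) {i}
      (by simpa using hi)
      (fun i' hi' hne p hp => by
        obtain ⟨j, hj, _⟩ := h2 i' hi' hne p hp
        simp at hj)
      (by rw [Finset.card_singleton]; omega) (fun _ => hB) (fun h => by omega)
    exact l.hasLocalDeadlock hAB hP (Or.inr hA) (Or.inl (hl ▸ Finset.singleton_nonempty i))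
  · have hdead : dead.Nonempty ∨ Proc.procA ∈ D := by
      rw [Finset.nonempty_iff_ne_empty]
      tauto
    obtain ⟨f, hf⟩ := Nat.exists_eq_add_of_le (h3.trans hN)
    obtain ⟨l, hl⟩ := hP.nonempty_layout (N := N) (f := f) dead h1 h2 (by omega) (fun _ => hB)
      (fun h => by
        -- A contested state without a dead copy leaves the quota unfilled, which forces `f > 0`.
        by_contra hcon
        push Not at hcon
        have := h4 hcon
        omega)
    by_cases hlive : 0 < f ∨ Proc.procA ∉ D
    · exact Or.inl (l.hasLocalDeadlock hAB hP hlive (hl ▸ hdead))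
    · push Not at hlive
      exact Or.inr ⟨by omega, l.hasGlobalDeadlock hAB hP (by omega) hlive.2⟩

end Profile

/-- The process of the system with one more copy of `B` that corresponds to `p`. -/
def Proc.castSucc : Proc n → Proc (n + 1)
  | .procA => .procA
  | .procB i => .procB i.castSucc

theorem Proc.castSucc_injective : Function.Injective (Proc.castSucc (n := n)) := by
  rintro (_ | i) (_ | j) h <;> simp_all [Proc.castSucc]

namespace Profile

variable {x : SI QA SA QB SB n} {D : Set (Proc n)}

/-- Without live copies of `B` no state is contested, so `D` blocks itself in the larger system too.
The profile gives no cycle for the new copy, so `hI` has to make the fair run initializing. -/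
theorem hasDeadlock_succ_of_forall (hAB : OneConjunctive A B) (hP : Profile A B x D)
    (hB : ∀ i, Proc.procB i ∈ D) (hn : 1 ≤ n) (hI : InitializingSystem A B (n + 1)) :
    HasDeadlock A B (n + 1) := by
  let φ : Fin (n + 1) → Option (Fin n) := fun j => if h : j.1 < n then some ⟨j, h⟩ else none
  have hφ : ∀ j j' i, φ j = some i → φ j' = some i → j = j' := by
    intro j j' i h h'
    simp only [φ, Option.dite_none_right_eq_some, Option.some.injEq] at h h'
    obtain ⟨_, rfl⟩ := h
    obtain ⟨_, h'⟩ := h'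
    exact Fin.ext (Fin.ext_iff.1 h').symm
  have hφc : ∀ i : Fin n, φ i.castSucc = some i := fun i => by simp [φ]
  -- The new copy needs some input; `1 ≤ n` provides that of copy `0`.
  have hreach := hP.reach.pull hAB (fun _ => x.2.b ⟨0, hn⟩) hφ
  have hs : ∀ p, (pull B φ (fun _ => x.2.b ⟨0, hn⟩) x).1.at p.castSucc = x.1.at p := by
    rintro (_ | i)
    · rfl
    · simp [pull, Proc.castSucc, Global.at, hφc]
  have hi : ∀ p, (pull B φ (fun _ => x.2.b ⟨0, hn⟩) x).2.at p.castSucc = x.2.at p := by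
    rintro (_ | i)
    · rfl
    · simp [pull, Proc.castSucc, Global.at, hφc]
  refine hasDeadlock_of_mutually_blocked hI hreach (D := Proc.castSucc '' D)
    (hP.dead_nonempty.image _) ?_
  rintro _ ⟨p, hp, rfl⟩ g hg
  rcases hP.blocked p hp g (hg.congr (hs p) (hi p)) with ⟨p', hp', hne, h⟩ | ⟨r, hr, _⟩
  · exact ⟨_, ⟨p', hp', rfl⟩, fun h => hne (Proc.castSucc_injective h), by rwa [hs]⟩
  · rw [hP.contested_eq_empty hB] at hr
    exact hr.elim

theorem hasDeadlock_succ [Finite QB] (hAB : OneConjunctive A B) (hP : Profile A B x D)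
    (hn : 1 ≤ n) (hI : InitializingSystem A B (n + 1)) : HasDeadlock A B (n + 1) := by
  classical
  by_cases hB : ∀ i, Proc.procB i ∈ D
  · exact hP.hasDeadlock_succ_of_forall hAB hB hn hI
  push Not at hB
  set dead := Finset.univ.filter fun i => Proc.procB i ∈ D with hdead
  have : Nonempty (Fin n) := ⟨hB.choose⟩
  choose! occ hoccD hocc using hP.occupied
  -- Distinct contested states have distinct live occupants, so among `n + 1` copies at least one
  -- filler remains.
  have hR : (Contested A B x D).ncard ≤ (deadᶜ).card := by
    rw [← Set.ncard_coe_finset]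
    refine Set.ncard_le_ncard_of_injOn occ (fun r hr => by simpa [hdead] using hoccD r hr) ?_
      (Set.toFinite _)
    intro r hr r' hr' h
    rw [← hocc r hr, ← hocc r' hr', h]
  have hc := Finset.card_add_card_compl dead
  rw [Fintype.card_fin] at hc
  obtain ⟨l, hl⟩ := hP.nonempty_layout (N := n + 1)
    (f := n + 1 - dead.card - (Contested A B x D).ncard) dead (fun i hi => by simpa [hdead] using hi)
    (fun i hi _ p hp => ⟨i, by simpa [hdead] using hi, hp.symm, rfl⟩)
    (by omega) (fun _ => hB) (fun h => by omega)
  refine Or.inr (l.hasLocalDeadlock hAB hP (Or.inl (by omega)) ?_)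
  obtain ⟨p, hp⟩ := hP.dead_nonempty
  cases p with
  | procA => exact Or.inr hp
  | procB i => exact Or.inl ⟨i, by simpa [hl, hdead] using hp⟩

end Profile

theorem HasGlobalDeadlock.bound [Finite QB] (hAB : OneConjunctive A B)
    (hn : 2 * ({B.init}ᶜ : Set QB).ncard ≤ n) (h : HasGlobalDeadlock A B n) :
    HasGlobalDeadlock A B (2 * ({B.init}ᶜ : Set QB).ncard) := by
  obtain ⟨x, hx, hd⟩ := hasGlobalDeadlock_iff.1 h
  have hP := Profile.of_global hx hd
  obtain ⟨l, _⟩ := hP.exists_layout_of_forall hAB (fun _ => trivial) le_rfl hn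
  exact l.hasGlobalDeadlock hAB hP rfl trivial

theorem HasDeadlock.bound [Finite QB] (hAB : OneConjunctive A B)
    (hk : 2 ≤ ({B.init}ᶜ : Set QB).ncard) (hn : 2 * ({B.init}ᶜ : Set QB).ncard ≤ n)
    (h : HasDeadlock A B n) : HasDeadlock A B (2 * ({B.init}ᶜ : Set QB).ncard) := by
  rcases h with h | h
  · exact Or.inl (h.bound hAB hn)
  · obtain ⟨x, D, hP, hD'⟩ := h.exists_profile hAB
    rcases hP.deadlock hAB hD' hk le_rfl hn with h | h
    · exact Or.inr h
    · exact Or.inl h.2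

theorem HasDeadlock.succ [Finite QB] (hAB : OneConjunctive A B) (hn : 1 ≤ n)
    (hI : InitializingSystem A B (n + 1)) (h : HasDeadlock A B n) : HasDeadlock A B (n + 1) := by
  rcases h with h | h
  · obtain ⟨x, hx, hd⟩ := hasGlobalDeadlock_iff.1 h
    exact (Profile.of_global hx hd).hasDeadlock_succ hAB hn hI
  · obtain ⟨x, D, hP, _⟩ := h.exists_profile hAB
    exact hP.hasDeadlock_succ hAB hn hI

end Counting
end GuardedProtocol

theorem mainTheorem10 {QA SA QB SB : Type*} [Finite QA] [Finite SA] [Finite QB] [Finite SB]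
    (A : GuardedProtocol.Template QA SA (QA ⊕ QB)) (B : GuardedProtocol.Template QB SB (QA ⊕ QB))
    (hAB : GuardedProtocol.OneConjunctive A B) :
    -- bounding: global deadlocks
    (∀ n, n > 2 * ({B.init}ᶜ : Set QB).ncard →
      GuardedProtocol.HasGlobalDeadlock A B n →
        GuardedProtocol.HasGlobalDeadlock A B (2 * ({B.init}ᶜ : Set QB).ncard)) ∧
    -- bounding: local deadlocks
    (2 < Nat.card QB → ∀ n, n > 2 * ({B.init}ᶜ : Set QB).ncard + 1 →
      GuardedProtocol.HasLocalDeadlock A B n →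
        GuardedProtocol.HasLocalDeadlock A B (2 * ({B.init}ᶜ : Set QB).ncard + 1)) ∧
    -- bounding: deadlocks in general
    (2 < Nat.card QB → ∀ n, n > 2 * ({B.init}ᶜ : Set QB).ncard →
      GuardedProtocol.HasDeadlock A B n →
        GuardedProtocol.HasDeadlock A B (2 * ({B.init}ᶜ : Set QB).ncard)) ∧
    -- monotonicity
    (∀ n, 1 ≤ n → GuardedProtocol.InitializingSystem A B (n + 1) →
      GuardedProtocol.HasDeadlock A B n → GuardedProtocol.HasDeadlock A B (n + 1)) ∧
    -- cutoff
    (2 < Nat.card QB →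
      (∀ n, n > 2 * Nat.card QB - 2 → GuardedProtocol.InitializingSystem A B n) →
        GuardedProtocol.IsDeadlockCutoff A B (2 * Nat.card QB - 2)) := by
  have hcard : 2 * ({B.init}ᶜ : Set QB).ncard = 2 * Nat.card QB - 2 := by
    have := Set.ncard_add_ncard_compl ({B.init} : Set QB)
    rw [Set.ncard_singleton] at this
    omega
  refine ⟨fun n hn h => h.bound hAB hn.le, fun hQ n hn h => ?_,
    fun hQ n hn h => h.bound hAB (by omega) hn.le, fun n hn hI h => h.succ hAB hn hI,
    fun hQ hI n hn => ⟨fun h => ?_, fun h => ?_⟩⟩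
  · obtain ⟨x, D, hP, hD⟩ := h.exists_profile hAB
    rcases hP.deadlock hAB hD (by omega) (Nat.le_succ _) hn.le with h | h
    · exact h
    -- The global alternative needs exactly `2 * |Q_B \ {init}|` copies, and here there is one more.
    · exact absurd h.1 (Nat.succ_ne_self _)
  · induction n, hn using Nat.le_induction with
    | base => exact h
    | succ m hm ih => exact ih.succ hAB (by omega) (hI _ (by omega))
  · rw [← hcard] at hn ⊢
    exact h.bound hAB (by omega) hn
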